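/- Let $\emptyset\neq\mathcal A\subseteq\mathbb Q^n$ and $\mathcal B\subseteq\mathbb N^n\setminus(2\mathbb N)^n$ be finite and disjoint. For $c\in\mathbb R^{\mathcal A\cup\mathcal B}$ let $f_c(x)=\sum_{\alpha\in\mathcal A}c_\alpha|x|^\alpha+\sum_{\beta\in\mathcal B}c_\beta x^\beta$ for $x\in\mathbb R^n$, with value $\infty$ if for some $\alpha\in\mathcal A$ with $c_\alpha\ne0$ and some $j$ one has $x_j=0$ and $\alpha_j<0$. Call $f_c$ an AG function if either at most one $c_\alpha$ ($\alpha\in\mathcal A$) is negative and all $c_\beta$ ($\beta\in\mathcal B$) are $0$, or all $c_\alpha$ ($\alpha\in\mathcal A$) are $\ge0$ and at most one $c_\beta$ ($\beta\in\mathcal B$) is nonzero. Let $C_{\mathcal S}(\mathcal A,\mathcal B)\subseteq\mathbb R^{\mathcal A\cup\mathcal B}$ be the conic hull of the coefficient vectors of all AG functions that are non-negative on $\mathbb R^n$, and let $C_{\mathcal S}(\mathcal A,\mathcal B)^*=\{v\in\mathbb R^{\mathcal A\cup\mathcal B}:\sum_\gamma v_\gamma c_\gamma\ge0\ \text{for all}\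 c\in C_{\mathcal S}(\mathcal A,\mathcal B)\}$. For $\mathcal I\in\{\mathcal A,\mathcal B\}$ let $R(\mathcal A,\mathcal I)$ be the set of pairs $(A,\beta)$ with $A\subseteq\mathcal A$ affinely independent, $\beta\in\operatorname{relint}(\operatorname{conv}A)\cap(\mathcal I\setminus A)$ and $(\mathcal A\cap\operatorname{conv}A)\setminus(A\cup\{\beta\})=\emptyset$. The elements of $R(\mathcal A,\mathcal A)$ are the even and those of $R(\mathcal A,\mathcal B)$ the odd reduced circuits. For such $(A,\beta)$ let $\lambda$ be the barycentric coordinates of $\beta$ with respect to $A$, let $p\ge1$ be their smallest common denominator, $\lambda_\alpha=p_\alpha/p$ with $p_\alpha\in\mathbb N$, and $L=\lceil\log_2p\rceil$ (so $L\ge1$). Take real variables $y_{k,i}$, $1\le k\le L-1$, $1\le i\le 2^{L-k}$, collected in $\mathbf y$. Given $v_{|A}\in\mathbb R^A$ and $t\in\mathbb R$, put $y_{L,1}:=t$ and let $y_{0,1},\dots,y_{0,2^L}$ be an arrangement in which each $v_\alpha$ ($\alpha\in A$) appears $p_\alpha$ times and $t$ appears $2^L-p$ times; such an arrangement exists, and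 one is fixed arbitrarily for each circuit. The dual circuit matrix $C^*_{A,\beta}(v_{|A},t,\mathbf y)$ is block diagonal with the blocks $$\begin{pmatrix}y_{k-1,2i-1}&y_{k,i}\\ y_{k,i}&y_{k-1,2i}\end{pmatrix}\quad(1\le k\le L,\ 1\le i\le 2^{L-k})$$ and the $1\times1$ block $(t)$. Then, for every choice of the arrangements, a vector $v\in\mathbb R^{\mathcal A\cup\mathcal B}$ lies in $C_{\mathcal S}(\mathcal A,\mathcal B)^*$ if and only if $v_\alpha\ge0$ for all $\alpha\in\mathcal A$ and there are real variables $\mathbf y^{A,\beta}$ for all even reduced circuits and $(y_\beta^{A,\beta},\mathbf y^{A,\beta})$ for all odd reduced circuits such that the following holds. For every odd reduced circuit $(A,\beta)\in R(\mathcal A,\mathcal B)$, with $t=y_\beta=y_\beta^{A,\beta}$ and $y_{k,i}=y^{A,\beta}_{k,i}$: 1. $\begin{pmatrix}y_{k-1,2i-1}&y_{k,i}\\ y_{k,i}&y_{k-1,2i}\end{pmatrix}\succeq0$ for $2\le k\le L-1$ and $1\le i\le 2^{L-k}$; 2. $\begin{pmatrix}y_{L-1,1}&y_\beta\\ y_\beta&y_{L-1,2}\end{pmatrix}\succeq0$;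 3. $\begin{pmatrix}u&y_{1,l}\\ y_{1,l}&w\end{pmatrix}\succeq0$ for $1\le l\le 2^{L-1}$, where $u=y_{0,2l-1}$ and $w=y_{0,2l}$; 4. $\|v_\beta\|_2\le y_\beta$. For every even reduced circuit $(A,\beta)\in R(\mathcal A,\mathcal A)$: $C^*_{A,\beta}(v_{|A},v_\beta,\mathbf y^{A,\beta})\succeq0$. Moreover, $C_{\mathcal S}(\mathcal A,\mathcal B)^*$ is the projection to the coordinates $v$ of the lifted cone $\widehat C^*(\mathcal A,\mathcal B)$ of all $(v,(\mathbf y^{A,\beta}),(y^{A,\beta}_\beta))$ such that $v_\alpha\ge0$ for all $\alpha\in\mathcal A$; $C^*_{A,\beta}(v_{|A},y^{A,\beta}_\beta,\mathbf y^{A,\beta})\succeq0$ and $\begin{pmatrix}y^{A,\beta}_\beta&v_\beta\\ v_\beta&y^{A,\beta}_\beta\end{pmatrix}\succeq0$ for all $(A,\beta)\in R(\mathcal A,\mathcal B)$; and $C^*_{A,\beta}(v_{|A},v_\beta,\mathbf y^{A,\beta})\succeq0$ for all $(A,\beta)\in R(\mathcal A,\mathcal A)$. -/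

import Mathlib

open Set Finset BigOperators

noncomputable section

namespace SCone

/-- Points (exponent vectors) of `ℝⁿ`. -/
abbrev Pt (n : ℕ) := Fin n → ℝ

/-- The point of `ℝⁿ` given by an exponent vector in `ℕⁿ`. -/
def toPt {n : ℕ} (b : Fin n → ℕ) : Pt n := fun j => (b j : ℝ)

/-- The coefficient space `ℝ^{(𝒜, ℬ)}`. -/
abbrev Coeff {n : ℕ} (𝒜 : Finset (Pt n)) (ℬ : Finset (Fin n → ℕ)) := (↥𝒜 ⊕ ↥ℬ) → ℝ

/-! ### The S-cone and its dual -/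

open Classical in
/-- The function `f(x) = ∑_{α ∈ 𝒜} c_α |x|^α + ∑_{β ∈ ℬ} c_β x^β` from `ℝⁿ` to `ℝ ∪ {∞}`.
Its value is `∞` when some `|x|^α` occurring with a nonzero coefficient is infinite, that is,
when a component of `x` vanishes and the corresponding component of `α` is negative. -/
def evalFun {n : ℕ} {𝒜 : Finset (Pt n)} {ℬ : Finset (Fin n → ℕ)} (c : Coeff 𝒜 ℬ)
    (x : Fin n → ℝ) : WithTop ℝ :=
  if ∃ α : ↥𝒜, c (Sum.inl α) ≠ 0 ∧ ∃ j, x j = 0 ∧ (α : Pt n) j < 0 then ⊤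
  else (((∑ α : ↥𝒜, c (Sum.inl α) * ∏ j, |x j| ^ ((α : Pt n) j)) +
      ∑ β : ↥ℬ, c (Sum.inr β) * ∏ j, (x j) ^ ((β : Fin n → ℕ) j) : ℝ) : WithTop ℝ)

/-- Even AG functions: at most one `c_α` (`α ∈ 𝒜`) is negative, all `c_β` (`β ∈ ℬ`) vanish. -/
def IsEvenAG {n : ℕ} {𝒜 : Finset (Pt n)} {ℬ : Finset (Fin n → ℕ)} (c : Coeff 𝒜 ℬ) : Prop :=
  (∀ α α' : ↥𝒜, c (Sum.inl α) < 0 → c (Sum.inl α') < 0 → α = α') ∧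
    ∀ β : ↥ℬ, c (Sum.inr β) = 0

/-- Odd AG functions: all `c_α` (`α ∈ 𝒜`) are non-negative, at most one `c_β` (`β ∈ ℬ`) is
nonzero. -/
def IsOddAG {n : ℕ} {𝒜 : Finset (Pt n)} {ℬ : Finset (Fin n → ℕ)} (c : Coeff 𝒜 ℬ) : Prop :=
  (∀ α : ↥𝒜, 0 ≤ c (Sum.inl α)) ∧
    ∀ β β' : ↥ℬ, c (Sum.inr β) ≠ 0 → c (Sum.inr β') ≠ 0 → β = β'

/-- The S-cone, in coefficients: the conic hull of the non-negative AG functions. -/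
def sCone {n : ℕ} (𝒜 : Finset (Pt n)) (ℬ : Finset (Fin n → ℕ)) : PointedCone ℝ (Coeff 𝒜 ℬ) :=
  PointedCone.hull ℝ {c | (IsEvenAG c ∨ IsOddAG c) ∧ ∀ x : Fin n → ℝ, 0 ≤ evalFun c x}

/-- The dual of the S-cone with respect to the pairing `v(f) = ∑ v_α c_α`. -/
def dualSCone {n : ℕ} (𝒜 : Finset (Pt n)) (ℬ : Finset (Fin n → ℕ)) : Set (Coeff 𝒜 ℬ) :=
  {v | ∀ c ∈ sCone 𝒜 ℬ, 0 ≤ ∑ i, v i * c i}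

/-! ### Reduced circuits -/

/-- The reduced circuits `(A, β)` with `A ⊆ 𝒜` and inner exponent `β` in the (injectively
indexed) set `{pt i | i : ι}`. -/
structure ReducedCircuit {n : ℕ} (𝒜 : Finset (Pt n)) {ι : Type} (pt : ι → Pt n) where
  /-- the set `A` of outer exponents -/
  outer : Finset (Pt n)
  /-- the index of the inner exponent `β` -/
  inner : ι
  outer_subset : outer ⊆ 𝒜
  affineIndependent : AffineIndependent ℝ (fun a : ↥outer => (a : Pt n))
  inner_notMem : pt inner ∉ outer
  inner_mem : pt inner ∈ intrinsicInterior ℝ (convexHull ℝ (outer : Set (Pt n)))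
  reduced : ((𝒜 : Set (Pt n)) ∩ convexHull ℝ (outer : Set (Pt n))) \
    ((outer : Set (Pt n)) ∪ {pt inner}) = ∅

/-- `R(𝒜, 𝒜)`: the even reduced circuits. -/
abbrev EvenCircuit {n : ℕ} (𝒜 : Finset (Pt n)) :=
  ReducedCircuit 𝒜 (fun a : ↥𝒜 => (a : Pt n))

/-- `R(𝒜, ℬ)`: the odd reduced circuits. -/
abbrev OddCircuit {n : ℕ} (𝒜 : Finset (Pt n)) (ℬ : Finset (Fin n → ℕ)) :=
  ReducedCircuit 𝒜 (fun b : ↥ℬ => toPt (b : Fin n → ℕ))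

/-! ### Barycentric coordinates and their smallest common denominator -/

/-- `lam` represents `β` as a convex combination of `A`. -/
def IsBary {n : ℕ} (A : Finset (Pt n)) (β : Pt n) (lam : ↥A → ℝ) : Prop :=
  (∀ a, 0 ≤ lam a) ∧ ∑ a, lam a = 1 ∧ ∑ a, lam a • (a : Pt n) = β

open Classical in
/-- The barycentric coordinates `λ(A, β)` (unique when `A` is affinely independent). -/
def bary {n : ℕ} (A : Finset (Pt n)) (β : Pt n) : ↥A → ℝ :=
  if h : ∃ lam, IsBary A β lam then h.choose else 0

/-- The smallest common denominator `p` of the barycentric coordinates: the least `p ≥ 1` such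
that every `λ_α` is `m / p` with `m ∈ ℕ`. -/
def denom {n : ℕ} (A : Finset (Pt n)) (β : Pt n) : ℕ :=
  sInf {p : ℕ | 0 < p ∧ ∀ a, ∃ m : ℕ, bary A β a = (m : ℝ) / (p : ℝ)}

/-- The numerators `p_α`, with `λ_α = p_α / p`. -/
def numer {n : ℕ} (A : Finset (Pt n)) (β : Pt n) (a : ↥A) : ℕ :=
  ⌊bary A β a * (denom A β : ℝ)⌋₊

/-- `⌈log₂ p⌉`. -/
def depth {n : ℕ} (A : Finset (Pt n)) (β : Pt n) : ℕ := Nat.clog 2 (denom A β)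

/-! ### Dual circuit variables and dual circuit matrices -/

/-- The indices `(k, i)` of the dual circuit variables: `k ∈ [L - 1]`, `i ∈ [2 ^ (L - k)]`. -/
def varIndex (L : ℕ) : Finset (Σ _ : ℕ, ℕ) :=
  (Finset.Icc 1 (L - 1)).sigma fun k => Finset.Icc 1 (2 ^ (L - k))

/-- The indices `(k, i)` of the `2 × 2` blocks: `k ∈ [L]`, `i ∈ [2 ^ (L - k)]`. -/
def blockIndex (L : ℕ) : Finset (Σ _ : ℕ, ℕ) :=
  (Finset.Icc 1 L).sigma fun k => Finset.Icc 1 (2 ^ (L - k))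

/-- An order of appearance of the variables `v_α` (`some α`) and `v_β` (`none`) at the
`2 ^ ⌈log₂ p⌉` places `u, w` of the lowest blocks: each `v_α` appears `p_α` times and `v_β`
appears `2 ^ ⌈log₂ p⌉ - p` times. The block number `l` receives the places `2l - 1` and `2l`. -/
structure Arrangement {n : ℕ} (A : Finset (Pt n)) (β : Pt n) where
  slot : ↥(Finset.Icc 1 (2 ^ depth A β)) → Option ↥A
  card_outer : ∀ a : ↥A, Nat.card {i // slot i = some a} = numer A β a
  card_inner : Nat.card {i // slot i = none} = 2 ^ depth A β - denom A β

/-- The variable `u` or `w` at a place. -/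
def leafVar {n : ℕ} {A : Finset (Pt n)} {β : Pt n} (σ : Arrangement A β) (vA : ↥A → ℝ) (vβ : ℝ)
    (i : ↥(Finset.Icc 1 (2 ^ depth A β))) : ℝ :=
  match σ.slot i with
  | some a => vA a
  | none => vβ

/-- The entries of the tree: level `0` carries the variables `u, w`, level `L = ⌈log₂ p⌉` carries
`v_β`, and the levels `k` in between carry the dual circuit variables `y_{k,i}`. -/
def node {n : ℕ} {A : Finset (Pt n)} {β : Pt n} (σ : Arrangement A β) (vA : ↥A → ℝ) (vβ : ℝ)
    (y : ↥(varIndex (depth A β)) → ℝ) (k i : ℕ) : ℝ :=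
  if k = 0 then
    (if h : i ∈ Finset.Icc 1 (2 ^ depth A β) then leafVar σ vA vβ ⟨i, h⟩ else 0)
  else if k = depth A β then vβ
  else if h : (⟨k, i⟩ : Σ _ : ℕ, ℕ) ∈ varIndex (depth A β) then y ⟨⟨k, i⟩, h⟩ else 0

/-- The symmetric `2 × 2` matrix with rows `(a, b)` and `(b, c)`. -/
def sym2 (a b c : ℝ) : Matrix (Fin 2) (Fin 2) ℝ := !![a, b; b, c]

/-- The dual circuit matrix `C*_{A,β}(v_A, v_β, y)`: block diagonal, with the `2 × 2` blocks
`(y_{k-1,2i-1}, y_{k,i}; y_{k,i}, y_{k-1,2i})`, where level `0` stands for the variables `u, w`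
and level `⌈log₂ p⌉` for `v_β`, and the singleton block `(v_β)`. -/
def dualCircuitMatrix {n : ℕ} {A : Finset (Pt n)} {β : Pt n} (σ : Arrangement A β)
    (vA : ↥A → ℝ) (vβ : ℝ) (y : ↥(varIndex (depth A β)) → ℝ) :
    Matrix ((Fin 2 × ↥(blockIndex (depth A β))) ⊕ Unit)
      ((Fin 2 × ↥(blockIndex (depth A β))) ⊕ Unit) ℝ :=
  Matrix.fromBlocks
    (Matrix.blockDiagonal fun q : ↥(blockIndex (depth A β)) =>
      sym2 (node σ vA vβ y (q.1.1 - 1) (2 * q.1.2 - 1)) (node σ vA vβ y q.1.1 q.1.2)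
        (node σ vA vβ y (q.1.1 - 1) (2 * q.1.2)))
    0 0 (Matrix.of fun _ _ => vβ)

/-- The matrix `Ĉ*_{A,β}(v_A, v_β, y_β, y)` of an odd circuit: block diagonal with the blocks
`C*_{A,β}(v_A, y_β, y)` and `(y_β, v_β; v_β, y_β)`. -/
def liftedCircuitMatrix {n : ℕ} {A : Finset (Pt n)} {β : Pt n} (σ : Arrangement A β)
    (vA : ↥A → ℝ) (vβ yβ : ℝ) (y : ↥(varIndex (depth A β)) → ℝ) :
    Matrix (((Fin 2 × ↥(blockIndex (depth A β))) ⊕ Unit) ⊕ Fin 2)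
      (((Fin 2 × ↥(blockIndex (depth A β))) ⊕ Unit) ⊕ Fin 2) ℝ :=
  Matrix.fromBlocks (dualCircuitMatrix σ vA yβ y) 0 0 (sym2 yβ vβ yβ)

/-! ### Notation for circuits -/

namespace ReducedCircuit

variable {n : ℕ} {𝒜 : Finset (Pt n)} {ι : Type} {pt : ι → Pt n}

/-- The inner exponent `β`. -/
def innerPt (C : ReducedCircuit 𝒜 pt) : Pt n := pt C.inner

/-- The orders of appearance for a circuit. -/
abbrev Arr (C : ReducedCircuit 𝒜 pt) := Arrangement C.outer C.innerPt

/-- The space of the variables `(y_{k,i})` of a circuit. -/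
abbrev Vars (C : ReducedCircuit 𝒜 pt) := ↥(varIndex (depth C.outer C.innerPt)) → ℝ

/-- The restriction `v_{|A}`. -/
def restr {ℬ : Finset (Fin n → ℕ)} (C : ReducedCircuit 𝒜 pt) (v : Coeff 𝒜 ℬ) : ↥C.outer → ℝ :=
  fun a => v (Sum.inl ⟨a, C.outer_subset a.2⟩)

end ReducedCircuit

/-! ### Orders of appearance exist for circuits with rational exponents -/

theorem exists_isBary {n : ℕ} {A : Finset (Pt n)} {β : Pt n}
    (h : β ∈ convexHull ℝ (A : Set (Pt n))) : ∃ lam, IsBary A β lam := by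
  rw [Finset.mem_convexHull'] at h
  obtain ⟨w, h0, h1, h2⟩ := h
  refine ⟨fun a => w a, fun a => h0 a a.2, ?_, ?_⟩
  · rw [← h1]; exact Finset.sum_coe_sort A w
  · rw [← h2]; exact Finset.sum_coe_sort A (fun a => w a • a)

theorem IsBary.rational {n : ℕ} {A : Finset (Pt n)} {β : Pt n} {lam : ↥A → ℝ}
    (h : IsBary A β lam) (hA : AffineIndependent ℝ (fun a : ↥A => (a : Pt n)))
    (hq : ∀ a ∈ A, ∀ j, ∃ q : ℚ, a j = (q : ℝ)) (hβ : ∀ j, ∃ q : ℚ, β j = (q : ℝ)) :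
    ∀ a, ∃ q : ℚ, lam a = (q : ℝ) := by
  obtain ⟨φ, hφ⟩ := LinearMap.exists_leftInverse_of_injective (Algebra.linearMap ℚ ℝ)
    (LinearMap.ker_eq_bot.2 (algebraMap ℚ ℝ).injective)
  have hφq : ∀ q : ℚ, φ (q : ℝ) = q := fun q => by
    simpa using LinearMap.congr_fun hφ q
  have hφm : ∀ (x : ℝ) (q : ℚ), φ (x * (q : ℝ)) = φ x * q := fun x q => by
    have : x * (q : ℝ) = q • x := by rw [Rat.smul_def, mul_comm]
    rw [this, map_smul, smul_eq_mul, mul_comm]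
  obtain ⟨-, h1, h2⟩ := h
  have key := (affineIndependent_iff.1 hA) Finset.univ (fun a => lam a - (φ (lam a) : ℝ)) ?_ ?_
  · intro a
    exact ⟨φ (lam a), sub_eq_zero.1 (key a (Finset.mem_univ a))⟩
  · rw [Finset.sum_sub_distrib, h1, ← Rat.cast_sum, ← map_sum, h1]
    have := hφq 1
    simp only [Rat.cast_one] at this
    simp [this]
  · simp only [sub_smul]
    rw [Finset.sum_sub_distrib, h2, sub_eq_zero]
    funext j
    obtain ⟨b, hb⟩ := hβ j
    have h2j := congrFun h2 j
    simp only [Finset.sum_apply, Pi.smul_apply, smul_eq_mul] at h2j ⊢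
    choose q hq' using fun a : ↥A => hq a a.2 j
    simp only [hq'] at h2j ⊢
    have := congrArg φ h2j
    rw [map_sum, hb, hφq] at this
    simp only [hφm] at this
    rw [hb, ← this]
    push_cast
    rfl

theorem denom_spec {n : ℕ} {A : Finset (Pt n)} {β : Pt n}
    (h : ∀ a, ∃ q : ℚ, bary A β a = (q : ℝ)) (h0 : ∀ a, 0 ≤ bary A β a) :
    0 < denom A β ∧ ∀ a, bary A β a = (numer A β a : ℝ) / (denom A β : ℝ) := by
  have hne : {p : ℕ | 0 < p ∧ ∀ a, ∃ m : ℕ, bary A β a = (m : ℝ) / (p : ℝ)}.Nonempty := by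
    choose q hq using h
    refine ⟨∏ a, (q a).den, Finset.prod_pos fun a _ => (q a).den_pos, fun a => ?_⟩
    obtain ⟨d, hd⟩ := Finset.dvd_prod_of_mem (fun a => (q a).den) (Finset.mem_univ a)
    have hd0 : d ≠ 0 := by
      rintro rfl
      exact (Finset.prod_pos fun a (_ : a ∈ Finset.univ) => (q a).den_pos).ne' (by simpa using hd)
    have hnum : 0 ≤ (q a).num := Rat.num_nonneg.2 (by have := h0 a; rw [hq] at this; exact_mod_cast this)
    refine ⟨(q a).num.toNat * d, ?_⟩
    rw [hq, hd]
    have h1 : ((q a).num.toNat : ℝ) = ((q a).num : ℝ) := by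
      exact_mod_cast congrArg (Int.cast : ℤ → ℝ) (Int.toNat_of_nonneg hnum)
    push_cast
    rw [h1, mul_div_mul_right _ _ (by exact_mod_cast hd0)]
    exact_mod_cast (Rat.num_div_den (q a)).symm
  obtain ⟨hp, hm⟩ := Nat.sInf_mem hne
  refine ⟨hp, fun a => ?_⟩
  obtain ⟨m, hm⟩ := hm a
  have hp' : ((denom A β : ℕ) : ℝ) ≠ 0 := by exact_mod_cast hp.ne'
  have hm' : bary A β a = (m : ℝ) / (denom A β : ℝ) := hm
  have : numer A β a = m := by
    rw [numer, hm', div_mul_cancel₀ _ hp', Nat.floor_natCast]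
  rw [this, hm']

theorem ReducedCircuit.nonempty_arr {n : ℕ} {𝒜 : Finset (Pt n)} {ι : Type} {pt : ι → Pt n}
    (C : ReducedCircuit 𝒜 pt) (hrat : ∀ α ∈ 𝒜, ∀ j, ∃ q : ℚ, α j = (q : ℝ))
    (hβ : ∀ j, ∃ q : ℚ, C.innerPt j = (q : ℝ)) : Nonempty C.Arr := by
  have hex := exists_isBary (intrinsicInterior_subset C.inner_mem)
  have hb : IsBary C.outer C.innerPt (bary C.outer C.innerPt) := by
    unfold bary
    rw [dif_pos (show ∃ lam, IsBary C.outer C.innerPt lam from hex)]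
    exact Exists.choose_spec _
  obtain ⟨hp, hn⟩ := denom_spec (hb.rational C.affineIndependent
    (fun a ha => hrat a (C.outer_subset ha)) hβ) hb.1
  have hsum : ∑ a, numer C.outer C.innerPt a = denom C.outer C.innerPt := by
    have h1 := hb.2.1
    simp only [hn] at h1
    rw [← Finset.sum_div, div_eq_one_iff_eq (by exact_mod_cast hp.ne')] at h1
    exact_mod_cast h1
  have hle : denom C.outer C.innerPt ≤ 2 ^ depth C.outer C.innerPt :=
    Nat.le_pow_clog (by norm_num) _
  let cnt : Option ↥C.outer → ℕ := fun o => o.elim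
    (2 ^ depth C.outer C.innerPt - denom C.outer C.innerPt) (numer C.outer C.innerPt)
  have hcard : Fintype.card ↥(Finset.Icc 1 (2 ^ depth C.outer C.innerPt)) =
      Fintype.card (Σ o, Fin (cnt o)) := by
    have h1 : Fintype.card (Σ o, Fin (cnt o)) = ∑ o, cnt o := by
      rw [Fintype.card_sigma]
      exact Finset.sum_congr rfl fun o _ => Fintype.card_fin _
    have h2 : ∑ o, cnt o = (2 ^ depth C.outer C.innerPt - denom C.outer C.innerPt) +
        ∑ a, numer C.outer C.innerPt a := Fintype.sum_option cnt
    rw [h1, h2, hsum, Fintype.card_coe, Nat.card_Icc]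
    omega
  let e := Fintype.equivOfCardEq hcard
  have hfib : ∀ o, Nat.card {i // (e i).1 = o} = cnt o := fun o => by
    have e1 : {i // (e i).1 = o} ≃ {s : Σ o, Fin (cnt o) // s.1 = o} :=
      e.subtypeEquiv fun _ => Iff.rfl
    rw [Nat.card_congr (e1.trans (Equiv.sigmaSubtype o)), Nat.card_fin]
  exact ⟨⟨fun i => (e i).1, fun a => hfib (some a), hfib none⟩⟩

/-! ### The conditions and the lifted cone -/

/-- The auxiliary variables of all odd reduced circuits, `(y_β, (y_{k,i}))` for each of them. -/
abbrev OddVars {n : ℕ} (𝒜 : Finset (Pt n)) (ℬ : Finset (Fin n → ℕ)) :=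
  (C : OddCircuit 𝒜 ℬ) → ℝ × C.Vars

/-- The auxiliary variables of all even reduced circuits, `(y_{k,i})` for each of them. -/
abbrev EvenVars {n : ℕ} (𝒜 : Finset (Pt n)) :=
  (C : EvenCircuit 𝒜) → C.Vars

/-- The condition of an even reduced circuit: `C*_{A,β}(v_A, v_β, y)` is positive
semidefinite. -/
def EvenCondition {n : ℕ} {𝒜 : Finset (Pt n)} {ℬ : Finset (Fin n → ℕ)} (C : EvenCircuit 𝒜)
    (σ : C.Arr) (v : Coeff 𝒜 ℬ) (y : C.Vars) : Prop :=
  (dualCircuitMatrix σ (C.restr v) (v (Sum.inl C.inner)) y).PosSemidef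

/-- The four conditions of an odd reduced circuit. -/
def OddCondition {n : ℕ} {𝒜 : Finset (Pt n)} {ℬ : Finset (Fin n → ℕ)} (C : OddCircuit 𝒜 ℬ)
    (σ : C.Arr) (v : Coeff 𝒜 ℬ) (yβ : ℝ) (y : C.Vars) : Prop :=
  let L := depth C.outer C.innerPt
  let e : ℕ → ℕ → ℝ := node σ (C.restr v) yβ y
  (∀ k i : ℕ, 2 ≤ k → k ≤ L - 1 → i ∈ Finset.Icc 1 (2 ^ (L - k)) →
    (sym2 (e (k - 1) (2 * i - 1)) (e k i) (e (k - 1) (2 * i))).PosSemidef) ∧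
  (sym2 (e (L - 1) 1) yβ (e (L - 1) 2)).PosSemidef ∧
  (∀ l ∈ Finset.Icc 1 (2 ^ (L - 1)),
    (sym2 (e 0 (2 * l - 1)) (e 1 l) (e 0 (2 * l))).PosSemidef) ∧
  ‖v (Sum.inr C.inner)‖ ≤ yβ

/-- The lifted cone `Ĉ*(𝒜, ℬ)`. The conditions `v_α ≥ 0` are those of the singleton circuits
`(α)`, whose dual circuit matrix is the single block `(v_α)`. -/
def liftedDualCone {n : ℕ} (𝒜 : Finset (Pt n)) (ℬ : Finset (Fin n → ℕ))
    (σodd : ∀ C : OddCircuit 𝒜 ℬ, C.Arr) (σeven : ∀ C : EvenCircuit 𝒜, C.Arr) :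
    Set (Coeff 𝒜 ℬ × (OddVars 𝒜 ℬ × EvenVars 𝒜)) :=
  {z | (∀ α : ↥𝒜, 0 ≤ z.1 (Sum.inl α)) ∧
    (∀ C : OddCircuit 𝒜 ℬ, (liftedCircuitMatrix (σodd C) (C.restr z.1) (z.1 (Sum.inr C.inner))
      (z.2.1 C).1 (z.2.1 C).2).PosSemidef) ∧
    (∀ C : EvenCircuit 𝒜, (dualCircuitMatrix (σeven C) (C.restr z.1) (z.1 (Sum.inl C.inner))
      (z.2.2 C)).PosSemidef)}

end SCone

end

/-!
The dual of the S-cone consists of the vectors `v` with `v_α ≥ 0` on `𝒜` that satisfy the circuit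
inequalities `v_β ≤ ∏ v_α ^ λ_α` (even circuits) and `|v_β| ≤ ∏ v_α ^ λ_α` (odd circuits) for all
reduced circuits (`SCone.mem_dualSCone_iff`). Each circuit inequality is then rewritten by means of
`2 × 2` positive semidefinite blocks.

*Necessity.* By the weighted inequality of arithmetic and geometric means, the circuit functions
`∑ λ_α s_α |x|^α - (∏ s_α ^ λ_α) |x|^β` are non-negative. Pairing `v` with them and optimizing over
`s` gives the circuit inequality (`SCone.le_prod_rpow_of_forall`).

*Sufficiency.* The S-cone need not be decomposed into circuit functions. After a perturbation all
`v_α` are positive, and `k = log v` satisfies Jensen inequalities for all reduced circuits. A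
maximum principle extends them to all convex combinations (`SCone.le_of_reduced`): if Jensen's
inequality fails somewhere, it fails on a simplex, where the excess of `k` over its affine
interpolation, with a small multiple of `|x|²` added, has an interior maximum at some point `γ`. But
`γ` lies inside a reduced circuit with vertices in the same simplex (`SCone.exists_reduced`; the
representation of `γ` with the smallest average of `|x|²` is reduced), and the Jensen inequality of
that circuit contradicts maximality. Hence `k` has a supporting affine function with gradient `y` at
the inner exponent, up to an error `ε` (`SCone.exists_support`), and evaluating a non-negative AG
function at the point `exp y` bounds its pairing with `v = exp k` from below
(`SCone.mul_exp_le_sum`). For odd AG functions a sign change of the coordinates makes the odd term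
negative.

*Semidefinite form.* The blocks of a dual circuit matrix say that every entry of a binary tree is
at most the geometric mean of its children, so the root `t` satisfies `t ^ 2 ^ L ≤ ∏ leaves`; as
`2 ^ L - p` leaves carry `t` itself, this is `t ^ p ≤ ∏ v_α ^ p_α`. Conversely, iterated geometric
means of the leaves fill the tree (`SCone.exists_posSemidef_dualCircuitMatrix_iff`).
-/

noncomputable section

namespace SCone

/-! ### Convex combinations over finite point sets -/

section Combinations

variable {V : Type*} [AddCommGroup V] [Module ℝ V]

/-- The weights `μ` (read on the finite set `S` only) represent `x` as a convex combination of
the points of `S`. -/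
def IsConvexComb (S : Finset V) (x : V) (μ : V → ℝ) : Prop :=
  (∀ s ∈ S, 0 ≤ μ s) ∧ ∑ s ∈ S, μ s = 1 ∧ ∑ s ∈ S, μ s • s = x

theorem mem_convexHull_iff_isConvexComb {S : Finset V} {x : V} :
    x ∈ convexHull ℝ (S : Set V) ↔ ∃ μ, IsConvexComb S x μ :=
  Finset.mem_convexHull'

/-- Carathéodory's theorem with a cost: a convex combination can be replaced by one of affinely
independent points, with positive weights, whose average cost is not larger. -/
theorem IsConvexComb.exists_affineIndependent_le (k : V → ℝ) {S : Finset V} {x : V} {μ : V → ℝ}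
    (h : IsConvexComb S x μ) :
    ∃ A ⊆ S, ∃ lam : V → ℝ, IsConvexComb A x lam ∧ (∀ a ∈ A, 0 < lam a) ∧
      AffineIndependent ℝ (fun a : ↥A => (a : V)) ∧
      ∑ a ∈ A, lam a * k a ≤ ∑ s ∈ S, μ s * k s := by
  classical
  induction S using Finset.strongInduction generalizing μ with
  | H S ih =>
    -- a point of weight zero can be dropped
    have drop : ∀ ν : V → ℝ, IsConvexComb S x ν → (∃ s ∈ S, ν s = 0) →
        ∑ s ∈ S, ν s * k s ≤ ∑ s ∈ S, μ s * k s →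
        ∃ A ⊆ S, ∃ lam : V → ℝ, IsConvexComb A x lam ∧ (∀ a ∈ A, 0 < lam a) ∧
          AffineIndependent ℝ (fun a : ↥A => (a : V)) ∧
          ∑ a ∈ A, lam a * k a ≤ ∑ s ∈ S, μ s * k s := by
      rintro ν ⟨h0, h1, h2⟩ ⟨s, hs, hs0⟩ hle
      have hν : IsConvexComb (S.erase s) x ν := by
        refine ⟨fun a ha => h0 a (Finset.mem_of_mem_erase ha), ?_, ?_⟩
        · rw [← h1, Finset.sum_erase _ hs0]
        · rw [← h2, Finset.sum_erase _ (by rw [hs0, zero_smul])]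
      obtain ⟨A, hA, lam, hl⟩ := ih _ (Finset.erase_ssubset hs) hν
      refine ⟨A, hA.trans (Finset.erase_subset _ _), lam, hl.1, hl.2.1, hl.2.2.1,
        hl.2.2.2.trans ?_⟩
      rwa [Finset.sum_erase _ (by rw [hs0, zero_mul])]
    by_cases hz : ∃ s ∈ S, μ s = 0
    · exact drop μ h hz le_rfl
    push Not at hz
    by_cases hi : AffineIndependent ℝ (fun a : ↥S => (a : V))
    · exact ⟨S, subset_rfl, μ, h, fun a ha => lt_of_le_of_ne (h.1 a ha) (hz a ha).symm, hi,
        le_rfl⟩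
    -- otherwise move along an affine dependency that does not increase the cost
    obtain ⟨w, hw0, hw1, hwk, hwn⟩ : ∃ w : V → ℝ, ∑ e ∈ S, w e • e = 0 ∧ ∑ e ∈ S, w e = 0 ∧
        ∑ e ∈ S, w e * k e ≤ 0 ∧ ∃ e ∈ S, w e ≠ 0 := by
      obtain ⟨f, f0, f1, e, he, hfe⟩ := exists_nontrivial_relation_sum_zero_of_not_affine_ind hi
      rcases le_total (∑ e ∈ S, f e * k e) 0 with hk | hk
      · exact ⟨f, f0, f1, hk, e, he, hfe⟩
      · refine ⟨fun e => - f e, ?_, ?_, ?_, e, he, neg_ne_zero.2 hfe⟩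
        · simp [f0]
        · simp [f1]
        · simpa using hk
    have hneg : ∃ e ∈ S, w e < 0 := by
      by_contra hcon
      push Not at hcon
      obtain ⟨e, he, hne⟩ := hwn
      exact hne ((Finset.sum_eq_zero_iff_of_nonneg hcon).1 hw1 e he)
    obtain ⟨e, he, hmin⟩ := Finset.exists_min_image (S.filter fun e => w e < 0)
      (fun e => μ e / (- w e)) (by obtain ⟨e, he, h⟩ := hneg; exact ⟨e, by simp [he, h]⟩)
    rw [Finset.mem_filter] at he
    set τ := μ e / (- w e) with hτ
    have hτ0 : 0 ≤ τ := div_nonneg (h.1 e he.1) (by linarith [he.2])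
    refine drop (fun a => μ a + τ * w a) ⟨fun a ha => ?_, ?_, ?_⟩ ⟨e, he.1, ?_⟩ ?_
    · rcases lt_or_ge (w a) 0 with hwa | hwa
      · have := hmin a (by simp [ha, hwa])
        rw [le_div_iff₀ (by linarith)] at this
        linarith
      · have := h.1 a ha
        positivity
    · rw [Finset.sum_add_distrib, ← Finset.mul_sum, hw1, h.2.1]; simp
    · simp only [add_smul, mul_smul]
      rw [Finset.sum_add_distrib, ← Finset.smul_sum, hw0, h.2.2]; simp
    · have : w e ≠ 0 := he.2.ne
      rw [hτ]; field_simp; ring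
    · have : ∑ s ∈ S, (μ s + τ * w s) * k s = ∑ s ∈ S, μ s * k s + τ * ∑ e ∈ S, w e * k e := by
        rw [Finset.mul_sum, ← Finset.sum_add_distrib]
        exact Finset.sum_congr rfl fun s _ => by ring
      rw [this]
      linarith [mul_nonpos_of_nonneg_of_nonpos hτ0 hwk]

end Combinations

theorem eq_of_affineIndependent {V : Type*} [AddCommGroup V] [Module ℝ V] {A : Finset V}
    (hA : AffineIndependent ℝ (fun a : ↥A => (a : V))) {μ ν : V → ℝ}
    (h1 : ∑ a ∈ A, μ a = ∑ a ∈ A, ν a) (h2 : ∑ a ∈ A, μ a • a = ∑ a ∈ A, ν a • a) :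
    ∀ a ∈ A, μ a = ν a := by
  intro a ha
  have := (affineIndependent_iff.1 hA) Finset.univ (fun a => μ a - ν a) ?_ ?_ ⟨a, ha⟩
    (Finset.mem_univ _)
  · exact sub_eq_zero.1 this
  · rw [Finset.sum_coe_sort A (fun a => μ a - ν a), Finset.sum_sub_distrib, h1, sub_self]
  · rw [Finset.sum_coe_sort A (fun a => (μ a - ν a) • a)]
    simp only [sub_smul]
    rw [Finset.sum_sub_distrib, h2, sub_self]

/-- A convex combination of affinely independent points with positive weights lies in the
relative interior of their convex hull: nearby points of the affine span still have positive
barycentric coordinates. -/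
theorem mem_intrinsicInterior_of_pos {V : Type*} [NormedAddCommGroup V] [NormedSpace ℝ V]
    [FiniteDimensional ℝ V] {A : Finset V} {x : V} {lam : V → ℝ}
    (hA : AffineIndependent ℝ (fun a : ↥A => (a : V))) (h : IsConvexComb A x lam)
    (hpos : ∀ a ∈ A, 0 < lam a) : x ∈ intrinsicInterior ℝ (convexHull ℝ (A : Set V)) := by
  classical
  rw [mem_intrinsicInterior]
  have hspan : affineSpan ℝ (convexHull ℝ (A : Set V)) = affineSpan ℝ (A : Set V) :=
    affineSpan_convexHull _
  rw [hspan]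
  have hne : (A : Set V).Nonempty := by
    by_contra hcon
    rw [Set.not_nonempty_iff_eq_empty, Finset.coe_eq_empty] at hcon
    have := h.2.1
    simp [hcon] at this
  have : Nonempty ↥(affineSpan ℝ (A : Set V)) := ((affineSpan_nonempty ℝ).2 hne).to_subtype
  have : Nonempty ↥A := hne.to_subtype
  let p : ↥A → ↥(affineSpan ℝ (A : Set V)) := fun a => ⟨a, subset_affineSpan ℝ _ a.2⟩
  have hp : AffineIndependent ℝ p :=
    AffineIndependent.of_comp (affineSpan ℝ (A : Set V)).subtype hA
  have htot : affineSpan ℝ (Set.range p) = ⊤ := by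
    have : Set.range p = ((↑) : affineSpan ℝ (A : Set V) → V) ⁻¹' (A : Set V) := by
      ext z
      constructor
      · rintro ⟨a, rfl⟩; exact a.2
      · intro hz; exact ⟨⟨z, hz⟩, rfl⟩
    rw [this]
    exact affineSpan_coe_preimage_eq_top _
  let b : AffineBasis ↥A ℝ ↥(affineSpan ℝ (A : Set V)) := ⟨p, hp, htot⟩
  have hcomb : ∀ w : ↥A → ℝ, ∑ a, w a = 1 →
      ((Finset.univ.affineCombination ℝ b w : affineSpan ℝ (A : Set V)) : V) =
        ∑ a, w a • (a : V) := by
    intro w hw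
    have := Finset.univ.map_affineCombination b w hw (affineSpan ℝ (A : Set V)).subtype
    rw [Finset.univ.affineCombination_eq_linear_combination _ _ hw] at this
    exact this
  have hx1 : ∑ a : ↥A, lam a = 1 := by rw [← h.2.1]; exact Finset.sum_coe_sort A lam
  refine ⟨Finset.univ.affineCombination ℝ b fun a => lam a, ?_, ?_⟩
  · rw [mem_interior]
    refine ⟨⋂ a : ↥A, {z | 0 < b.coord a z}, ?_, ?_, ?_⟩
    · intro z hz
      rw [Set.mem_iInter] at hz
      have hs : ∑ a, b.coord a z = 1 := b.sum_coord_apply_eq_one z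
      have hz' := hcomb (fun a => b.coord a z) hs
      rw [b.affineCombination_coord_eq_self z] at hz'
      rw [Set.mem_preimage, hz']
      exact (convex_convexHull ℝ _).sum_mem (fun a _ => (hz a).le) hs
        fun a _ => subset_convexHull ℝ _ a.2
    · exact isOpen_iInter_of_finite fun a =>
        isOpen_lt continuous_const (continuous_barycentric_coord b a)
    · rw [Set.mem_iInter]
      intro a
      rw [Set.mem_ofPred_eq, b.coord_apply_combination_of_mem (Finset.mem_univ a) hx1]
      exact hpos a a.2
  · rw [hcomb _ hx1, ← h.2.2]
    exact Finset.sum_coe_sort A (fun a => lam a • a)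

section

/-! ### Reduced circuits through energy minimization -/

variable {n : ℕ}

/-- The squared Euclidean norm on `ℝⁿ`, used as a strictly convex function. -/
def energy (x : Pt n) : ℝ := ∑ j, x j ^ 2

theorem energy_nonneg (x : Pt n) : 0 ≤ energy x := Finset.sum_nonneg fun _ _ => sq_nonneg _

theorem IsConvexComb.apply {S : Finset (Pt n)} {x : Pt n} {μ : Pt n → ℝ}
    (h : IsConvexComb S x μ) (j : Fin n) : ∑ s ∈ S, μ s * s j = x j := by
  rw [← h.2.2]; simp [Finset.sum_apply]

/-- Strict Jensen inequality for the energy. -/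
theorem IsConvexComb.energy_lt {S : Finset (Pt n)} {x : Pt n} {μ : Pt n → ℝ}
    (h : IsConvexComb S x μ) (hx : x ∉ S) : energy x < ∑ s ∈ S, μ s * energy s := by
  have hvar : ∑ s ∈ S, μ s * energy (s - x) = ∑ s ∈ S, μ s * energy s - energy x := by
    have h1 : ∀ s ∈ S, μ s * energy (s - x) =
        μ s * energy s - ∑ j, 2 * x j * (μ s * s j) + μ s * energy x := by
      intro s _
      simp only [energy, Pi.sub_apply, Finset.mul_sum]
      rw [← Finset.sum_sub_distrib, ← Finset.sum_add_distrib]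
      exact Finset.sum_congr rfl fun j _ => by ring
    rw [Finset.sum_congr rfl h1, Finset.sum_add_distrib, Finset.sum_sub_distrib,
      ← Finset.sum_mul, h.2.1, Finset.sum_comm]
    simp only [← Finset.mul_sum, h.apply]
    have : ∑ j, 2 * x j * x j = 2 * energy x := by
      rw [energy, Finset.mul_sum]
      exact Finset.sum_congr rfl fun j _ => by ring
    rw [this]; ring
  have hpos : 0 < ∑ s ∈ S, μ s * energy (s - x) := by
    obtain ⟨s, hs, hs0⟩ : ∃ s ∈ S, μ s ≠ 0 := by
      by_contra hcon
      push Not at hcon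
      have := h.2.1
      rw [Finset.sum_eq_zero hcon] at this
      exact zero_ne_one this
    refine Finset.sum_pos' (fun a ha => mul_nonneg (h.1 a ha) (energy_nonneg _)) ⟨s, hs, ?_⟩
    refine mul_pos (lt_of_le_of_ne (h.1 s hs) hs0.symm) ?_
    obtain ⟨j, hj⟩ : ∃ j, s j ≠ x j := by
      by_contra hcon
      push Not at hcon
      exact hx (funext hcon ▸ hs)
    exact Finset.sum_pos' (fun _ _ => sq_nonneg _)
      ⟨j, Finset.mem_univ _, by have : s j - x j ≠ 0 := sub_ne_zero.2 hj
                                simp only [Pi.sub_apply]; positivity⟩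
  linarith

/-- A cost function attains its minimum over the convex representations of a point by a finite
set. -/
theorem exists_isConvexComb_min {S : Finset (Pt n)} {x : Pt n} (k : Pt n → ℝ)
    (hx : x ∈ convexHull ℝ (S : Set (Pt n))) :
    ∃ μ, IsConvexComb S x μ ∧
      ∀ ν, IsConvexComb S x ν → ∑ s ∈ S, μ s * k s ≤ ∑ s ∈ S, ν s * k s := by
  classical
  let K : Set (↥S → ℝ) := stdSimplex ℝ ↥S ∩ {w | ∑ s, w s • (s : Pt n) = x}
  have hK : IsCompact K := (isCompact_stdSimplex ℝ ↥S).inter_right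
    (isClosed_eq (by fun_prop) continuous_const)
  have toK : ∀ ν, IsConvexComb S x ν → (fun s : ↥S => ν s) ∈ K := by
    rintro ν ⟨h0, h1, h2⟩
    refine ⟨⟨fun s => h0 s s.2, ?_⟩, ?_⟩
    · rw [← h1]; exact Finset.sum_coe_sort S ν
    · rw [Set.mem_ofPred_eq, ← h2]; exact Finset.sum_coe_sort S (fun s => ν s • s)
  obtain ⟨ν₀, hν₀⟩ := mem_convexHull_iff_isConvexComb.1 hx
  obtain ⟨w, hw, hmin⟩ := hK.exists_isMinOn ⟨_, toK ν₀ hν₀⟩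
    (f := fun w => ∑ s, w s * k s) (by fun_prop)
  let μ : Pt n → ℝ := fun s => if h : s ∈ S then w ⟨s, h⟩ else 0
  have hμ : ∀ s : ↥S, μ s = w s := fun s => by simp [μ]
  refine ⟨μ, ⟨fun s hs => ?_, ?_, ?_⟩, fun ν hν => ?_⟩
  · rw [hμ ⟨s, hs⟩]; exact hw.1.1 _
  · rw [← Finset.sum_coe_sort S μ]; simp only [hμ]; exact hw.1.2
  · rw [← Finset.sum_coe_sort S (fun s => μ s • s)]; simp only [hμ]; exact hw.2
  · have := hmin (toK ν hν)
    simp only [Set.mem_ofPred_eq] at this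
    rw [← Finset.sum_coe_sort S (fun s => μ s * k s), ← Finset.sum_coe_sort S (fun s => ν s * k s)]
    simpa only [hμ] using this

/-- Every convex combination of points of `S` lies in the relative interior
of a simplex with vertices in `S` that contains no further point of `S`. The representation of
smallest average energy has this property, because an extra point could be used to lower the
energy further. -/
theorem exists_reduced {S : Finset (Pt n)} {x : Pt n}
    (hx : x ∈ convexHull ℝ (S : Set (Pt n))) :
    ∃ B ⊆ S, AffineIndependent ℝ (fun a : ↥B => (a : Pt n)) ∧
      x ∈ intrinsicInterior ℝ (convexHull ℝ (B : Set (Pt n))) ∧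
      ∀ z ∈ S, z ∈ convexHull ℝ (B : Set (Pt n)) → z ∈ B := by
  classical
  obtain ⟨μ, hμ, hmin⟩ := exists_isConvexComb_min energy hx
  obtain ⟨B, hBS, lam, hlam, hpos, hB, hle⟩ := hμ.exists_affineIndependent_le energy
  refine ⟨B, hBS, hB, mem_intrinsicInterior_of_pos hB hlam hpos, fun z hz hzB => ?_⟩
  by_contra hzn
  obtain ⟨ν, hν⟩ := mem_convexHull_iff_isConvexComb.1 hzB
  have hBne : B.Nonempty := by
    by_contra hcon
    rw [Finset.not_nonempty_iff_eq_empty] at hcon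
    have := hlam.2.1
    simp [hcon] at this
  obtain ⟨b, hb, hbmin⟩ := Finset.exists_min_image B lam hBne
  set τ := lam b with hτ
  have hτ0 : 0 < τ := hpos b hb
  have hν1 : ∀ a ∈ B, ν a ≤ 1 := fun a ha => by
    rw [← hν.2.1]; exact Finset.single_le_sum hν.1 ha
  -- shift the mass `τ` from the representation of `z` by `B` to `z` itself
  let ρ : Pt n → ℝ := fun a => if a = z then τ else if a ∈ B then lam a - τ * ν a else 0
  have hsum : ∀ {W : Type} [AddCommGroup W] [Module ℝ W] (g : Pt n → W),
      ∑ a ∈ S, ρ a • g a = τ • g z + (∑ a ∈ B, lam a • g a - τ • ∑ a ∈ B, ν a • g a) := by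
    intro W _ _ g
    have hsub : insert z B ⊆ S := Finset.insert_subset hz hBS
    rw [← Finset.sum_subset hsub, Finset.sum_insert hzn]
    · congr 1
      · simp [ρ]
      · rw [Finset.smul_sum, ← Finset.sum_sub_distrib]
        refine Finset.sum_congr rfl fun a ha => ?_
        have : a ≠ z := fun h => hzn (h ▸ ha)
        simp [ρ, this, ha, sub_smul, mul_smul]
    · intro a _ ha
      rw [Finset.mem_insert, not_or] at ha
      simp [ρ, ha.1, ha.2]
  have hρ : IsConvexComb S x ρ := by
    refine ⟨fun a _ => ?_, ?_, ?_⟩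
    · by_cases h1 : a = z
      · simp [ρ, h1, hτ0.le]
      · by_cases h2 : a ∈ B
        · simp only [ρ, h1, h2, if_true, if_false]
          nlinarith [hbmin a h2, hν1 a h2]
        · simp [ρ, h1, h2]
    · have := hsum (fun _ => (1 : ℝ))
      simpa [hlam.2.1, hν.2.1] using this
    · have := hsum (fun a => a)
      simpa [hlam.2.2, hν.2.2] using this
  have h1 := hmin ρ hρ
  have h2 := hsum energy
  simp only [smul_eq_mul] at h2
  have h3 := hν.energy_lt hzn
  nlinarith

end

section

variable {n : ℕ}

/-! ### A maximum principle -/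

/-- `(B, γ)` is a reduced circuit with respect to `𝒜`. In contrast to `ReducedCircuit`, this treats
even and odd inner exponents `γ` alike, as points. -/
structure IsReducedAt (𝒜 B : Finset (Pt n)) (γ : Pt n) : Prop where
  subset : B ⊆ 𝒜
  notMem : γ ∉ B
  affineIndependent : AffineIndependent ℝ (fun a : ↥B => (a : Pt n))
  mem_intrinsicInterior : γ ∈ intrinsicInterior ℝ (convexHull ℝ (B : Set (Pt n)))
  reduced : ∀ z ∈ 𝒜, z ∈ convexHull ℝ (B : Set (Pt n)) → z = γ ∨ z ∈ B

/-- If a function satisfies strict Jensen inequalities on all reduced circuits then it satisfies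
the Jensen inequality for all convex combinations. If this failed for `β`, it would fail on a
simplex `A`; then the excess of `k` over its affine interpolation on `A` has a positive maximum on
the points in the simplex, at a point `γ` outside of `A`, and this contradicts the strict
inequality of a reduced circuit around `γ` within the simplex. -/
theorem le_of_reduced_lt {𝒜 : Finset (Pt n)} {β : Pt n} {k : Pt n → ℝ}
    (hred : ∀ γ ∈ insert β 𝒜, ∀ B, IsReducedAt 𝒜 B γ → ∃ lam, IsConvexComb B γ lam ∧
      k γ < ∑ b ∈ B, lam b * k b)
    {S : Finset (Pt n)} (hS : S ⊆ 𝒜) {μ : Pt n → ℝ} (hμ : IsConvexComb S β μ) :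
    k β ≤ ∑ s ∈ S, μ s * k s := by
  classical
  by_contra! hlt
  obtain ⟨A, hAS, lam, hlam, -, hA, hle⟩ := hμ.exists_affineIndependent_le k
  have hlt' := hle.trans_lt hlt
  have hex : ∀ x : Pt n, ∃ ν, x ∈ convexHull ℝ (A : Set (Pt n)) → IsConvexComb A x ν := fun x => by
    by_cases hx : x ∈ convexHull ℝ (A : Set (Pt n))
    · obtain ⟨ν, hν⟩ := mem_convexHull_iff_isConvexComb.1 hx
      exact ⟨ν, fun _ => hν⟩
    · exact ⟨0, fun h => absurd h hx⟩
  choose ν hν using hex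
  -- the affine interpolation of `k` on `A`
  let ℓ : Pt n → ℝ := fun x => ∑ a ∈ A, ν x a * k a
  have hℓ : ∀ x w, IsConvexComb A x w → ℓ x = ∑ a ∈ A, w a * k a := fun x w hw => by
    have hx := hν x (mem_convexHull_iff_isConvexComb.2 ⟨w, hw⟩)
    refine Finset.sum_congr rfl fun a ha => ?_
    rw [eq_of_affineIndependent hA (hx.2.1.trans hw.2.1.symm) (hx.2.2.trans hw.2.2.symm) a ha]
  have hℓA : ∀ a ∈ A, ℓ a = k a := fun a ha => by
    rw [hℓ a (fun b => if b = a then 1 else 0)]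
    · simp [ha]
    · refine ⟨fun b _ => by positivity, by simp [ha], by simp [ha]⟩
  let P : Finset (Pt n) := insert β (𝒜.filter fun x => x ∈ convexHull ℝ (A : Set (Pt n)))
  have hβ : β ∈ convexHull ℝ (A : Set (Pt n)) := mem_convexHull_iff_isConvexComb.2 ⟨lam, hlam⟩
  have hP : ∀ x ∈ P, x ∈ convexHull ℝ (A : Set (Pt n)) ∧ x ∈ insert β 𝒜 := fun x hx => by
    rw [Finset.mem_insert, Finset.mem_filter] at hx
    rcases hx with rfl | hx
    · exact ⟨hβ, Finset.mem_insert_self _ _⟩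
    · exact ⟨hx.2, Finset.mem_insert_of_mem hx.1⟩
  obtain ⟨γ, hγP, hmax⟩ := Finset.exists_max_image P (fun x => k x - ℓ x)
    ⟨β, Finset.mem_insert_self _ _⟩
  have hγpos : 0 < k γ - ℓ γ := by
    have := hmax β (Finset.mem_insert_self _ _)
    rw [hℓ β lam hlam] at this
    linarith
  have hγA : γ ∉ A := fun h => by rw [hℓA γ h] at hγpos; linarith
  -- a reduced circuit around `γ` whose outer exponents lie in the simplex `conv A`
  let T : Finset (Pt n) := (𝒜.filter fun x => x ∈ convexHull ℝ (A : Set (Pt n))).erase γ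
  have hAT : A ⊆ T := fun a ha => by
    refine Finset.mem_erase.2 ⟨fun h => hγA (h ▸ ha), Finset.mem_filter.2 ⟨hS (hAS ha), ?_⟩⟩
    exact subset_convexHull ℝ _ ha
  obtain ⟨B, hBT, hB, hri, hBred⟩ := exists_reduced (S := T) (x := γ)
    (convexHull_mono (Finset.coe_subset.2 hAT) (hP γ hγP).1)
  have hBA : ∀ b ∈ B, b ∈ 𝒜 ∧ b ∈ convexHull ℝ (A : Set (Pt n)) := fun b hb => by
    have := Finset.mem_of_mem_erase (hBT hb)
    rwa [Finset.mem_filter] at this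
  have hconv : convexHull ℝ (B : Set (Pt n)) ⊆ convexHull ℝ (A : Set (Pt n)) :=
    convexHull_min (fun b hb => (hBA b hb).2) (convex_convexHull ℝ _)
  have hR : IsReducedAt 𝒜 B γ := by
    refine ⟨fun b hb => (hBA b hb).1, fun h => ?_, hB, hri, fun z hz hzB => ?_⟩
    · exact Finset.ne_of_mem_erase (hBT h) rfl
    · by_cases hzγ : z = γ
      · exact Or.inl hzγ
      · exact Or.inr (hBred z (Finset.mem_erase.2
          ⟨hzγ, Finset.mem_filter.2 ⟨hz, hconv hzB⟩⟩) hzB)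
  obtain ⟨w, hw, hwk⟩ := hred γ (hP γ hγP).2 B hR
  have hℓγ : ℓ γ = ∑ b ∈ B, w b * ℓ b := by
    rw [hℓ γ (fun a => ∑ b ∈ B, w b * ν b a)]
    · simp only [ℓ, Finset.sum_mul, Finset.mul_sum]
      rw [Finset.sum_comm]
      exact Finset.sum_congr rfl fun b _ => Finset.sum_congr rfl fun a _ => by ring
    · refine ⟨fun a ha => Finset.sum_nonneg fun b hb =>
        mul_nonneg (hw.1 b hb) ((hν b (hBA b hb).2).1 a ha), ?_, ?_⟩
      · rw [Finset.sum_comm, ← hw.2.1]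
        refine Finset.sum_congr rfl fun b hb => ?_
        rw [← Finset.mul_sum, (hν b (hBA b hb).2).2.1, mul_one]
      · simp only [Finset.sum_smul]
        rw [Finset.sum_comm]
        conv_rhs => rw [← hw.2.2]
        refine Finset.sum_congr rfl fun b hb => ?_
        simp only [mul_smul]
        rw [← Finset.smul_sum, (hν b (hBA b hb).2).2.2]
  have : ∑ b ∈ B, w b * (k b - ℓ b) ≤ k γ - ℓ γ := by
    have h1 : ∑ b ∈ B, w b * (k b - ℓ b) ≤ ∑ b ∈ B, w b * (k γ - ℓ γ) :=
      Finset.sum_le_sum fun b hb => mul_le_mul_of_nonneg_left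
        (hmax b (Finset.mem_insert_of_mem (Finset.mem_filter.2 (hBA b hb)))) (hw.1 b hb)
    rwa [← Finset.sum_mul, hw.2.1, one_mul] at h1
  simp only [mul_sub, Finset.sum_sub_distrib] at this
  linarith

/-- Jensen inequalities on all reduced circuits imply those for all convex combinations. The
inequalities become strict after adding a small multiple of the energy. -/
theorem le_of_reduced {𝒜 : Finset (Pt n)} {β : Pt n} {k : Pt n → ℝ}
    (hred : ∀ γ ∈ insert β 𝒜, ∀ B, IsReducedAt 𝒜 B γ → ∃ lam, IsConvexComb B γ lam ∧
      k γ ≤ ∑ b ∈ B, lam b * k b)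
    {S : Finset (Pt n)} (hS : S ⊆ 𝒜) {μ : Pt n → ℝ} (hμ : IsConvexComb S β μ) :
    k β ≤ ∑ s ∈ S, μ s * k s := by
  have hexp : ∀ (T : Finset (Pt n)) (w : Pt n → ℝ) (δ : ℝ), ∑ b ∈ T, w b * (k b + δ * energy b) =
      ∑ b ∈ T, w b * k b + δ * ∑ b ∈ T, w b * energy b := fun T w δ => by
    rw [Finset.mul_sum, ← Finset.sum_add_distrib]
    exact Finset.sum_congr rfl fun b _ => by ring
  have key : ∀ δ : ℝ, 0 < δ → k β + δ * energy β ≤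
      ∑ s ∈ S, μ s * k s + δ * ∑ s ∈ S, μ s * energy s := fun δ hδ => by
    rw [← hexp]
    refine le_of_reduced_lt (k := fun x => k x + δ * energy x) (fun γ hγ B hB => ?_) hS hμ
    obtain ⟨lam, hlam, hle⟩ := hred γ hγ B hB
    refine ⟨lam, hlam, ?_⟩
    rw [hexp]
    have := mul_lt_mul_of_pos_left (hlam.energy_lt hB.notMem) hδ
    linarith
  have hcont : Filter.Tendsto (fun δ : ℝ => ∑ s ∈ S, μ s * k s + δ * ∑ s ∈ S, μ s * energy s -
      δ * energy β) (nhdsWithin 0 (Set.Ioi 0))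
      (nhds (∑ s ∈ S, μ s * k s + 0 * ∑ s ∈ S, μ s * energy s - 0 * energy β)) :=
    Filter.Tendsto.mono_left (Continuous.tendsto (by fun_prop) 0) nhdsWithin_le_nhds
  have := ge_of_tendsto hcont (b := k β)
    (Filter.eventually_of_mem self_mem_nhdsWithin fun δ hδ => by linarith [key δ hδ])
  simpa using this

/-! ### Supporting hyperplanes -/

/-- A finite function with the Jensen inequality at `β` is supported at `β`, up to an arbitrarily
small error, by an affine function. -/
theorem exists_support {S : Finset (Pt n)} {β : Pt n} {k : Pt n → ℝ}
    (h : ∀ μ, IsConvexComb S β μ → k β ≤ ∑ s ∈ S, μ s * k s) {ε : ℝ} (hε : 0 < ε) :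
    ∃ y : Fin n → ℝ, ∀ s ∈ S, k β - ε + ∑ j, y j * (s j - β j) ≤ k s := by
  classical
  have hlin : ∀ f : StrongDual ℝ (Pt n), ∀ x, f x = ∑ j, f (Pi.single j 1) * x j := fun f x => by
    conv_lhs => rw [← Finset.univ_sum_single x, map_sum]
    refine Finset.sum_congr rfl fun j _ => ?_
    have : Pi.single j (x j) = x j • (Pi.single j (1 : ℝ) : Pt n) := by
      rw [← Pi.single_smul]; simp
    rw [this, map_smul, smul_eq_mul, mul_comm]
  let G : Set (Pt n × ℝ) := (fun s : Pt n => (s, k s)) '' (S : Set (Pt n))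
  have hG : G.Finite := S.finite_toSet.image _
  let R : Set (Pt n × ℝ) := {β} ×ˢ Set.Iic (k β - ε)
  have hdisj : Disjoint (convexHull ℝ G) R := by
    rw [Set.disjoint_left]
    rintro ⟨x, t⟩ hx ⟨hx1, hx2⟩
    simp only [Set.mem_singleton_iff] at hx1
    subst hx1
    have hGS : G = ((S.image fun s : Pt n => (s, k s) : Finset (Pt n × ℝ)) : Set _) := by
      simp [G]
    rw [hGS, mem_convexHull_iff_isConvexComb] at hx
    obtain ⟨w, h0, h1, h2⟩ := hx
    have hinj : Set.InjOn (fun s : Pt n => (s, k s)) (S : Set (Pt n)) := fun a _ b _ hab =>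
      congrArg Prod.fst hab
    rw [Finset.sum_image hinj] at h1 h2
    have h2a := congrArg Prod.fst h2
    have h2b := congrArg Prod.snd h2
    simp only [Prod.fst_sum, Prod.snd_sum, Prod.smul_fst, Prod.smul_snd, smul_eq_mul] at h2a h2b
    have := h (fun s => w (s, k s))
      ⟨fun s hs => h0 _ (Finset.mem_image_of_mem _ hs), h1, h2a⟩
    simp only [Set.mem_Iic] at hx2
    linarith
  obtain ⟨f, u, v, hfu, huv, hfv⟩ := geometric_hahn_banach_compact_closed
    (convex_convexHull ℝ G) (hG.isCompact_convexHull ℝ)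
    ((convex_singleton β).prod (convex_Iic _)) (isClosed_singleton.prod isClosed_Iic) hdisj
  let g : StrongDual ℝ (Pt n) := f.comp (ContinuousLinearMap.inl ℝ (Pt n) ℝ)
  let c : ℝ := f (0, 1)
  have hf : ∀ x t, f (x, t) = g x + t * c := fun x t => by
    have : (x, t) = (x, (0 : ℝ)) + t • ((0 : Pt n), (1 : ℝ)) := by simp
    rw [this, map_add, map_smul, smul_eq_mul]; rfl
  have hS : ∀ s ∈ S, g s + k s * c < u := fun s hs => by
    rw [← hf]; exact hfu _ (subset_convexHull ℝ _ ⟨s, hs, rfl⟩)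
  have hR : ∀ t ≤ k β - ε, v < g β + t * c := fun t ht => by
    rw [← hf]; exact hfv _ ⟨rfl, ht⟩
  have hc : c ≤ 0 := by
    by_contra! hc
    have h1 := hR (min (k β - ε) ((v - g β) / c)) (min_le_left _ _)
    have h2 : min (k β - ε) ((v - g β) / c) * c ≤ (v - g β) / c * c :=
      mul_le_mul_of_nonneg_right (min_le_right _ _) hc.le
    rw [div_mul_cancel₀ _ hc.ne'] at h2
    linarith
  have hsep : ∀ s ∈ S, g s + k s * c < g β + (k β - ε) * c := fun s hs => by
    linarith [hS s hs, hR _ le_rfl]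
  have hg : ∀ s : Pt n, ∑ j, g (Pi.single j 1) * (s j - β j) = g s - g β := fun s => by
    rw [← map_sub, hlin g (s - β)]; rfl
  -- a multiple of `g` is the required functional; a vertical hyperplane allows any large multiple
  suffices hT : ∃ T : ℝ, ∀ s ∈ S, k β - ε + T * (g s - g β) ≤ k s by
    obtain ⟨T, hT⟩ := hT
    refine ⟨fun j => T * g (Pi.single j 1), fun s hs => ?_⟩
    have := hT s hs
    rw [← hg, Finset.mul_sum] at this
    simpa only [mul_assoc] using this
  rcases hc.lt_or_eq with hc | hc
  · refine ⟨(-c)⁻¹, fun s hs => ?_⟩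
    have h1 := hsep s hs
    have h2 : (-c)⁻¹ * (g s - g β) ≤ k s - (k β - ε) := by
      rw [inv_mul_le_iff₀ (by linarith)]
      linarith
    linarith
  · rw [hc] at hsep
    simp only [mul_zero, add_zero] at hsep
    refine ⟨∑ s ∈ S, |k β - ε - k s| / (g β - g s), fun s hs => ?_⟩
    have h1 := hsep s hs
    have h2 : |k β - ε - k s| / (g β - g s) ≤ ∑ s ∈ S, |k β - ε - k s| / (g β - g s) :=
      Finset.single_le_sum (f := fun s => |k β - ε - k s| / (g β - g s))
        (fun a ha => div_nonneg (abs_nonneg _) (by linarith [hsep a ha])) hs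
    rw [div_le_iff₀ (by linarith)] at h2
    linarith [le_abs_self (k β - ε - k s)]

end

section

variable {n : ℕ}

/-! ### From circuit inequalities to inequalities for AG functions -/

theorem le_of_forall_pos_continuous {f g : ℝ → ℝ} (hf : Continuous f) (hg : Continuous g)
    (h : ∀ ε, 0 < ε → f ε ≤ g ε) : f 0 ≤ g 0 :=
  le_of_tendsto_of_tendsto (b := nhdsWithin 0 (Set.Ioi 0))
    ((hf.tendsto 0).mono_left nhdsWithin_le_nhds) ((hg.tendsto 0).mono_left nhdsWithin_le_nhds)
    (Filter.eventually_of_mem self_mem_nhdsWithin fun ε hε => h ε hε)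

/-- Evaluating a non-negative signomial with one negative term at the exponential of a supporting
functional of `k` bounds its pairing with `exp k`. -/
theorem mul_exp_le_sum {S : Finset (Pt n)} {β : Pt n} {k c : Pt n → ℝ} {d : ℝ}
    (hk : ∀ μ, IsConvexComb S β μ → k β ≤ ∑ s ∈ S, μ s * k s) (hc : ∀ s ∈ S, 0 ≤ c s)
    (hf : ∀ x : Fin n → ℝ, (∀ j, 0 < x j) →
      d * ∏ j, x j ^ β j ≤ ∑ s ∈ S, c s * ∏ j, x j ^ s j) :
    d * Real.exp (k β) ≤ ∑ s ∈ S, c s * Real.exp (k s) := by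
  have key : ∀ ε, 0 < ε → d * Real.exp (k β - ε) ≤ ∑ s ∈ S, c s * Real.exp (k s) := by
    intro ε hε
    obtain ⟨y, hy⟩ := exists_support hk hε
    have hexp : ∀ s : Pt n, ∏ j, Real.exp (y j) ^ s j = Real.exp (∑ j, y j * s j) := fun s => by
      rw [Real.exp_sum]
      exact Finset.prod_congr rfl fun j _ => by rw [Real.exp_mul]
    have h1 := hf (fun j => Real.exp (y j)) fun j => Real.exp_pos _
    simp only [hexp] at h1
    have h2 := mul_le_mul_of_nonneg_right h1
      (Real.exp_pos (k β - ε - ∑ j, y j * β j)).le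
    rw [mul_assoc, ← Real.exp_add, Finset.sum_mul] at h2
    have h3 : ∑ j, y j * β j + (k β - ε - ∑ j, y j * β j) = k β - ε := by ring
    rw [h3] at h2
    refine h2.trans (Finset.sum_le_sum fun s hs => ?_)
    rw [mul_assoc, ← Real.exp_add]
    refine mul_le_mul_of_nonneg_left (Real.exp_le_exp.2 ?_) (hc s hs)
    have h4 := hy s hs
    simp only [mul_sub, Finset.sum_sub_distrib] at h4
    linarith
  have := le_of_forall_pos_continuous (f := fun ε => d * Real.exp (k β - ε))
    (g := fun _ => ∑ s ∈ S, c s * Real.exp (k s)) (by fun_prop) (by fun_prop) key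
  simpa using this

/-- The circuit inequalities of the reduced circuits bound the pairing with a non-negative
signomial that has only one negative term. Vanishing coordinates of `w` are replaced by small
positive ones, which keeps the circuit inequalities valid. -/
theorem mul_le_sum_of_reduced {𝒜 S : Finset (Pt n)} {β : Pt n} {w c : Pt n → ℝ} {d : ℝ}
    (hw : ∀ a ∈ 𝒜, 0 ≤ w a)
    (hcirc : ∀ γ ∈ insert β 𝒜, ∀ B, IsReducedAt 𝒜 B γ → ∃ lam, IsConvexComb B γ lam ∧
      w γ ≤ ∏ b ∈ B, w b ^ lam b)
    (hwβ : 0 ≤ w β) (hS : S ⊆ 𝒜) (hc : ∀ s ∈ S, 0 ≤ c s)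
    (hf : ∀ x : Fin n → ℝ, (∀ j, 0 < x j) →
      d * ∏ j, x j ^ β j ≤ ∑ s ∈ S, c s * ∏ j, x j ^ s j) :
    d * w β ≤ ∑ s ∈ S, c s * w s := by
  have key : ∀ ε, 0 < ε → d * max (w β) ε ≤ ∑ s ∈ S, c s * max (w s) ε := by
    intro ε hε
    have hpos : ∀ x, 0 < max (w x) ε := fun x => lt_max_of_lt_right hε
    have hexp : ∀ x, Real.exp (Real.log (max (w x) ε)) = max (w x) ε := fun x =>
      Real.exp_log (hpos x)
    have := mul_exp_le_sum (k := fun x => Real.log (max (w x) ε)) (fun μ hμ =>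
      le_of_reduced (k := fun x => Real.log (max (w x) ε)) (fun γ hγ B hB => ?_) hS hμ) hc hf
    · simpa only [hexp] using this
    · obtain ⟨lam, hlam, hle⟩ := hcirc γ hγ B hB
      refine ⟨lam, hlam, ?_⟩
      have hprod : max (w γ) ε ≤ ∏ b ∈ B, max (w b) ε ^ lam b := by
        refine max_le (hle.trans (Finset.prod_le_prod
          (fun b hb => Real.rpow_nonneg (hw b (hB.subset hb)) _) fun b hb =>
          Real.rpow_le_rpow (hw b (hB.subset hb)) (le_max_left _ _) (hlam.1 b hb))) ?_
        calc ε = ε ^ (∑ b ∈ B, lam b) := by rw [hlam.2.1, Real.rpow_one]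
          _ = ∏ b ∈ B, ε ^ lam b := Real.rpow_sum_of_pos hε _ _
          _ ≤ _ := Finset.prod_le_prod (fun b _ => Real.rpow_nonneg hε.le _) fun b hb =>
            Real.rpow_le_rpow hε.le (le_max_right _ _) (hlam.1 b hb)
      refine (Real.log_le_log (hpos γ) hprod).trans_eq ?_
      rw [Real.log_prod fun b _ => (Real.rpow_pos_of_pos (hpos b) _).ne']
      exact Finset.sum_congr rfl fun b _ => Real.log_rpow (hpos b) _
  have := le_of_forall_pos_continuous (f := fun ε => d * max (w β) ε)
    (g := fun ε => ∑ s ∈ S, c s * max (w s) ε) (by fun_prop) (by fun_prop) key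
  rw [max_eq_left hwβ, Finset.sum_congr rfl fun s hs => by rw [max_eq_left (hw s (hS hs))]] at this
  exact this

theorem bary_spec {A : Finset (Pt n)} {β : Pt n} (h : β ∈ convexHull ℝ (A : Set (Pt n))) :
    IsBary A β (bary A β) := by
  unfold bary
  rw [dif_pos (exists_isBary h)]
  exact (exists_isBary h).choose_spec

theorem ReducedCircuit.isBary {𝒜 : Finset (Pt n)} {ι : Type} {pt : ι → Pt n}
    (C : ReducedCircuit 𝒜 pt) : IsBary C.outer C.innerPt (bary C.outer C.innerPt) :=
  bary_spec (intrinsicInterior_subset C.inner_mem)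

/-- The weighted geometric mean `∏ v_α ^ λ_α` of a vector on the outer exponents of a circuit. -/
def geomMean {𝒜 : Finset (Pt n)} {ℬ : Finset (Fin n → ℕ)} {ι : Type} {pt : ι → Pt n}
    (C : ReducedCircuit 𝒜 pt) (v : Coeff 𝒜 ℬ) : ℝ :=
  ∏ a, C.restr v a ^ bary C.outer C.innerPt a

/-- The circuit inequality of a `ReducedCircuit` in terms of weights on all points. -/
theorem exists_weights_of_le_geomMean {𝒜 : Finset (Pt n)} {ℬ : Finset (Fin n → ℕ)} {ι : Type}
    {pt : ι → Pt n} {v : Coeff 𝒜 ℬ} {w : Pt n → ℝ} (hw : ∀ a : ↥𝒜, w a = v (Sum.inl a))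
    {t : ι → ℝ} (i : ι) (hC : ∀ C : ReducedCircuit 𝒜 pt, t C.inner ≤ geomMean C v)
    {B : Finset (Pt n)} (hB : IsReducedAt 𝒜 B (pt i)) :
    ∃ lam, IsConvexComb B (pt i) lam ∧ t i ≤ ∏ b ∈ B, w b ^ lam b := by
  classical
  let C : ReducedCircuit 𝒜 pt :=
    { outer := B
      inner := i
      outer_subset := hB.subset
      affineIndependent := hB.affineIndependent
      inner_notMem := hB.notMem
      inner_mem := hB.mem_intrinsicInterior
      reduced := by
        ext z
        simp only [Set.mem_sdiff, Set.mem_inter_iff, Set.mem_union, Set.mem_singleton_iff,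
          Set.mem_empty_iff_false, iff_false, not_and, not_not]
        exact fun h => (hB.reduced z h.1 h.2).symm }
  have hb := C.isBary
  let lam : Pt n → ℝ := fun x => if h : x ∈ B then bary B (pt i) ⟨x, h⟩ else 0
  have hlam : ∀ b : ↥B, lam b = bary B (pt i) b := fun b => by simp [lam]
  refine ⟨lam, ⟨fun s hs => ?_, ?_, ?_⟩, ?_⟩
  · rw [hlam ⟨s, hs⟩]; exact hb.1 _
  · rw [← Finset.sum_coe_sort B lam]; simp only [hlam]; exact hb.2.1
  · rw [← Finset.sum_coe_sort B (fun s => lam s • s)]; simp only [hlam]; exact hb.2.2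
  · refine (hC C).trans_eq ?_
    rw [← Finset.prod_coe_sort B (fun b => w b ^ lam b)]
    refine Finset.prod_congr rfl fun b _ => ?_
    rw [hlam b, hw ⟨b, hB.subset b.2⟩]
    rfl

/-! ### Pairings and evaluations -/

/-- The values at `x` of the functions `|x|^α` and `x^β`. -/
def monomials (𝒜 : Finset (Pt n)) (ℬ : Finset (Fin n → ℕ)) (x : Fin n → ℝ) : Coeff 𝒜 ℬ :=
  Sum.elim (fun α => ∏ j, |x j| ^ ((α : Pt n) j)) (fun β => ∏ j, x j ^ ((β : Fin n → ℕ) j))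

variable {𝒜 : Finset (Pt n)} {ℬ : Finset (Fin n → ℕ)}

theorem evalFun_nonneg {c : Coeff 𝒜 ℬ} {x : Fin n → ℝ}
    (h : (∀ α : ↥𝒜, c (Sum.inl α) ≠ 0 → ∀ j, x j = 0 → 0 ≤ (α : Pt n) j) →
      0 ≤ ∑ i, monomials 𝒜 ℬ x i * c i) : 0 ≤ evalFun c x := by
  unfold evalFun
  split_ifs with hx
  · exact le_top
  · push Not at hx
    have := h hx
    rw [Fintype.sum_sum_type] at this
    simp only [monomials, Sum.elim_inl, Sum.elim_inr, mul_comm _ (c _)] at this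
    exact_mod_cast this

theorem sum_nonneg_of_evalFun_nonneg {c : Coeff 𝒜 ℬ} {x : Fin n → ℝ} (hx : ∀ j, x j ≠ 0)
    (h : 0 ≤ evalFun c x) : 0 ≤ ∑ i, monomials 𝒜 ℬ x i * c i := by
  unfold evalFun at h
  rw [if_neg (by push Not; exact fun α _ j hj => absurd hj (hx j))] at h
  rw [Fintype.sum_sum_type]
  simp only [monomials, Sum.elim_inl, Sum.elim_inr, mul_comm _ (c _)]
  exact_mod_cast h

/-! ### The circuit inequalities imply membership in the dual cone -/

theorem exists_extend (f : ↥𝒜 → ℝ) (r : ℝ) :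
    ∃ g : Pt n → ℝ, (∀ a : ↥𝒜, g a = f a) ∧ ∀ x ∉ 𝒜, g x = r := by
  classical
  exact ⟨fun x => if h : x ∈ 𝒜 then f ⟨x, h⟩ else r, fun a => by simp, fun x hx => by simp [hx]⟩

/-- The only negative coefficient `c_γ` of an even AG function plays the role of the inner term;
the remaining exponents `𝒜 \ {γ}` carry the non-negative coefficients. -/
theorem pairing_nonneg_of_isEvenAG {v c : Coeff 𝒜 ℬ} (hv : ∀ α : ↥𝒜, 0 ≤ v (Sum.inl α))
    (heven : ∀ C : EvenCircuit 𝒜, v (Sum.inl C.inner) ≤ geomMean C v)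
    (hc : IsEvenAG c) (hpos : ∀ x, 0 ≤ evalFun c x) : 0 ≤ ∑ i, v i * c i := by
  classical
  rw [Fintype.sum_sum_type]
  simp only [hc.2, mul_zero, Finset.sum_const_zero, add_zero]
  by_cases hneg : ∃ α : ↥𝒜, c (Sum.inl α) < 0
  swap
  · push Not at hneg
    exact Finset.sum_nonneg fun α _ => mul_nonneg (hv α) (hneg α)
  obtain ⟨γ, hγ⟩ := hneg
  obtain ⟨w, hw, -⟩ := exists_extend (fun a => v (Sum.inl a)) 0
  obtain ⟨e, he, -⟩ := exists_extend (fun a => c (Sum.inl a)) 0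
  have hsplit : ∀ g : Pt n → ℝ, ∑ a : ↥𝒜, g a * c (Sum.inl a) =
      g γ * c (Sum.inl γ) + ∑ s ∈ 𝒜.erase γ, e s * g s := fun g => by
    have h1 : ∑ a : ↥𝒜, g a * c (Sum.inl a) = ∑ a ∈ 𝒜, g a * e a := by
      rw [← Finset.sum_coe_sort 𝒜 (fun a => g a * e a)]
      exact Finset.sum_congr rfl fun a _ => by rw [he]
    rw [h1, ← Finset.add_sum_erase _ _ γ.2, he]
    congr 1
    exact Finset.sum_congr rfl fun a _ => mul_comm _ _
  have := mul_le_sum_of_reduced (𝒜 := 𝒜) (S := 𝒜.erase γ) (β := (γ : Pt n)) (w := w) (c := e)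
    (d := - c (Sum.inl γ)) (fun a ha => by rw [hw ⟨a, ha⟩]; exact hv _) ?_
    (by rw [hw]; exact hv _) (Finset.erase_subset _ _) ?_ ?_
  · have h2 : ∑ a : ↥𝒜, v (Sum.inl a) * c (Sum.inl a) = ∑ a : ↥𝒜, w a * c (Sum.inl a) :=
      Finset.sum_congr rfl fun a _ => by rw [hw]
    rw [h2, hsplit w]
    linarith
  · intro γ' hγ' B hB
    rw [Finset.insert_eq_of_mem γ.2] at hγ'
    have := exists_weights_of_le_geomMean (v := v) hw (t := fun a => v (Sum.inl a)) ⟨γ', hγ'⟩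
      heven hB
    rw [← hw] at this
    exact this
  · intro s hs
    rw [he ⟨s, Finset.mem_of_mem_erase hs⟩]
    by_contra! hlt
    exact Finset.ne_of_mem_erase hs (congrArg Subtype.val (hc.1 _ _ hlt hγ))
  · intro x hx
    have h1 := sum_nonneg_of_evalFun_nonneg (fun j => (hx j).ne') (hpos x)
    rw [Fintype.sum_sum_type] at h1
    simp only [hc.2, mul_zero, Finset.sum_const_zero, add_zero, monomials, Sum.elim_inl,
      abs_of_pos (hx _)] at h1
    rw [hsplit (fun a => ∏ j, x j ^ a j)] at h1
    linarith

/-- A monomial with an odd exponent takes both signs on every orbit of sign changes. -/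
theorem exists_sign_change {b : Fin n → ℕ} (hb : ¬ ∀ j, Even (b j)) (r : ℝ) {x : Fin n → ℝ}
    (hx : ∀ j, 0 < x j) :
    ∃ z : Fin n → ℝ, (∀ j, |z j| = x j) ∧ (∏ j, z j ^ b j) * r = - |r| * ∏ j, x j ^ b j := by
  classical
  rcases lt_or_ge r 0 with hr | hr
  · exact ⟨x, fun j => abs_of_pos (hx j), by rw [abs_of_neg hr]; ring⟩
  · push Not at hb
    obtain ⟨i, hi⟩ := hb
    refine ⟨Function.update x i (- x i), fun j => ?_, ?_⟩
    · by_cases hj : j = i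
      · subst hj; simp [abs_of_pos (hx j)]
      · simp [hj, abs_of_pos (hx j)]
    · rw [abs_of_nonneg hr, ← Finset.mul_prod_erase _ _ (Finset.mem_univ i),
        ← Finset.mul_prod_erase _ (fun j => x j ^ b j) (Finset.mem_univ i)]
      rw [Finset.prod_congr (g := fun j => x j ^ b j) rfl fun j hj => by
        rw [Function.update_of_ne (Finset.ne_of_mem_erase hj)]]
      rw [Function.update_self, (Nat.not_even_iff_odd.1 hi).neg_pow]
      ring

/-- After a sign change of the coordinates, a non-negative odd AG function bounds
`|c_β| |x|^β` by its terms with exponents in `𝒜`. The point `β` is not in `𝒜`, so `|v_β|` can be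
assigned to it independently of the coordinates of `v` on `𝒜`. -/
theorem pairing_nonneg_of_isOddAG {v c : Coeff 𝒜 ℬ} (hℬ : ∀ β ∈ ℬ, ¬ ∀ j, Even (β j))
    (hdisj : ∀ β ∈ ℬ, toPt β ∉ 𝒜) (hv : ∀ α : ↥𝒜, 0 ≤ v (Sum.inl α))
    (heven : ∀ C : EvenCircuit 𝒜, v (Sum.inl C.inner) ≤ geomMean C v)
    (hodd : ∀ C : OddCircuit 𝒜 ℬ, |v (Sum.inr C.inner)| ≤ geomMean C v)
    (hc : IsOddAG c) (hpos : ∀ x, 0 ≤ evalFun c x) : 0 ≤ ∑ i, v i * c i := by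
  classical
  rw [Fintype.sum_sum_type]
  by_cases hne : ∃ β : ↥ℬ, c (Sum.inr β) ≠ 0
  swap
  · push Not at hne
    simp only [hne, mul_zero, Finset.sum_const_zero, add_zero]
    exact Finset.sum_nonneg fun α _ => mul_nonneg (hv α) (hc.1 α)
  obtain ⟨β, hβ⟩ := hne
  have hsingle : ∀ g : ↥ℬ → ℝ, ∑ b, g b * c (Sum.inr b) = g β * c (Sum.inr β) := fun g => by
    refine Finset.sum_eq_single β (fun b _ hb => ?_) (by simp)
    by_contra h
    exact hb (hc.2 b β (right_ne_zero_of_mul h) hβ)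
  obtain ⟨w, hw, hw'⟩ := exists_extend (fun a => v (Sum.inl a)) |v (Sum.inr β)|
  obtain ⟨e, he, -⟩ := exists_extend (fun a => c (Sum.inl a)) 0
  have hwβ := hw' _ (hdisj β β.2)
  have hsum : ∀ g : Pt n → ℝ, ∑ a : ↥𝒜, g a * c (Sum.inl a) = ∑ s ∈ 𝒜, e s * g s := fun g => by
    rw [← Finset.sum_coe_sort 𝒜 (fun a => e a * g a)]
    exact Finset.sum_congr rfl fun a _ => by rw [he, mul_comm]
  have := mul_le_sum_of_reduced (𝒜 := 𝒜) (S := 𝒜) (β := toPt β) (w := w) (c := e)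
    (d := |c (Sum.inr β)|) (fun a ha => by rw [hw ⟨a, ha⟩]; exact hv _) ?_
    (by rw [hwβ]; exact abs_nonneg _) subset_rfl
    (fun s hs => by rw [he ⟨s, hs⟩]; exact hc.1 _) ?_
  · have h2 : ∑ a : ↥𝒜, v (Sum.inl a) * c (Sum.inl a) = ∑ a : ↥𝒜, w a * c (Sum.inl a) :=
      Finset.sum_congr rfl fun a _ => by rw [hw]
    rw [h2, hsum w, hsingle (fun b => v (Sum.inr b))]
    rw [hwβ, ← abs_mul, mul_comm] at this
    linarith [neg_abs_le (v (Sum.inr β) * c (Sum.inr β))]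
  · intro γ hγ B hB
    rw [Finset.mem_insert] at hγ
    rcases hγ with rfl | hγ
    · have := exists_weights_of_le_geomMean (v := v) hw (t := fun b => |v (Sum.inr b)|) β hodd hB
      rw [← hwβ] at this
      exact this
    · have := exists_weights_of_le_geomMean (v := v) hw (t := fun a => v (Sum.inl a)) ⟨γ, hγ⟩
        heven hB
      rw [← hw] at this
      exact this
  · intro x hx
    obtain ⟨z, hz, hzr⟩ := exists_sign_change (hℬ β β.2) (c (Sum.inr β)) hx
    have h1 := sum_nonneg_of_evalFun_nonneg
      (fun j h => (hx j).ne' (by rw [← hz, h, abs_zero])) (hpos z)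
    rw [Fintype.sum_sum_type] at h1
    simp only [monomials, Sum.elim_inl, Sum.elim_inr, hz] at h1
    rw [hsum (fun a => ∏ j, x j ^ a j), hsingle (fun b => ∏ j, z j ^ (b : Fin n → ℕ) j),
      hzr] at h1
    have h3 : ∏ j, x j ^ toPt (β : Fin n → ℕ) j = ∏ j, x j ^ (β : Fin n → ℕ) j :=
      Finset.prod_congr rfl fun j _ => Real.rpow_natCast _ _
    rw [h3]
    linarith

theorem mem_dualSCone_of_forall {v : Coeff 𝒜 ℬ}
    (h : ∀ c : Coeff 𝒜 ℬ, (IsEvenAG c ∨ IsOddAG c) → (∀ x, 0 ≤ evalFun c x) →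
      0 ≤ ∑ i, v i * c i) : v ∈ dualSCone 𝒜 ℬ := by
  intro c hc
  induction hc using Submodule.span_induction with
  | mem c hc => exact h c hc.1 hc.2
  | zero => simp
  | add c d _ _ hc hd =>
    simp only [Pi.add_apply, mul_add, Finset.sum_add_distrib]
    exact add_nonneg hc hd
  | smul r c _ hc =>
    have : ∑ i, v i * (r • c) i = (r : ℝ) * ∑ i, v i * c i := by
      rw [Finset.mul_sum]
      refine Finset.sum_congr rfl fun i _ => ?_
      have : (r • c) i = (r : ℝ) * c i := rfl
      rw [this]; ring
    rw [this]
    exact mul_nonneg r.2 hc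

end

section

variable {n : ℕ} {𝒜 : Finset (Pt n)} {ℬ : Finset (Fin n → ℕ)}

/-! ### Circuit functions, and the necessity of the circuit inequalities -/

/-- The weighted inequality of arithmetic and geometric means for monomials: the non-negativity of
the circuit function `∑ λ_a s_a |x|^a - (∏ s_a ^ λ_a) |x|^β`. -/
theorem prod_mul_monomial_le {A : Finset (Pt n)} {β : Pt n} {lam s : ↥A → ℝ}
    (hlam : IsBary A β lam) (hs : ∀ a, 0 ≤ s a) {x : Fin n → ℝ}
    (hx : ∀ a, lam a ≠ 0 → ∀ j, x j = 0 → 0 ≤ (a : Pt n) j) :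
    (∏ a, s a ^ lam a) * ∏ j, |x j| ^ β j ≤
      ∑ a, lam a * s a * ∏ j, |x j| ^ ((a : Pt n) j) := by
  have hmon : ∀ a : ↥A, 0 ≤ ∏ j, |x j| ^ ((a : Pt n) j) := fun a =>
    Finset.prod_nonneg fun j _ => Real.rpow_nonneg (abs_nonneg _) _
  have h := Real.geom_mean_le_arith_mean_weighted Finset.univ lam
    (fun a => s a * ∏ j, |x j| ^ ((a : Pt n) j)) (fun a _ => hlam.1 a) hlam.2.1
    (fun a _ => mul_nonneg (hs a) (hmon a))
  have hβ : ∏ a : ↥A, (∏ j, |x j| ^ ((a : Pt n) j)) ^ lam a = ∏ j, |x j| ^ β j := by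
    have h1 : ∀ a : ↥A, (∏ j, |x j| ^ ((a : Pt n) j)) ^ lam a =
        ∏ j, |x j| ^ (lam a * (a : Pt n) j) := fun a => by
      rw [← Real.finsetProd_rpow _ _ fun j _ => Real.rpow_nonneg (abs_nonneg _) _]
      exact Finset.prod_congr rfl fun j _ => by
        rw [← Real.rpow_mul (abs_nonneg _), mul_comm]
    simp only [h1]
    rw [Finset.prod_comm]
    refine Finset.prod_congr rfl fun j _ => ?_
    have h2 : β j = ∑ a : ↥A, lam a * (a : Pt n) j := by
      rw [← hlam.2.2]; simp [Finset.sum_apply]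
    rw [h2]
    by_cases hj : x j = 0
    · refine (Real.rpow_sum_of_nonneg (abs_nonneg _) fun a _ => ?_).symm
      by_cases ha : lam a = 0
      · simp [ha]
      · exact mul_nonneg (hlam.1 a) (hx a ha j hj)
    · exact (Real.rpow_sum_of_pos (abs_pos.2 hj) _ _).symm
  have hlhs : ∏ a : ↥A, (s a * ∏ j, |x j| ^ ((a : Pt n) j)) ^ lam a =
      (∏ a, s a ^ lam a) * ∏ j, |x j| ^ β j := by
    rw [← hβ, ← Finset.prod_mul_distrib]
    exact Finset.prod_congr rfl fun a _ => Real.mul_rpow (hs a) (hmon a)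
  rw [hlhs] at h
  simpa only [mul_assoc] using h

open Classical in
/-- The coefficient vector with the coefficients `u` on the outer exponents of a circuit and `r` on
a further exponent `i₀`. -/
def circuitCoeff {ι : Type} {pt : ι → Pt n} (C : ReducedCircuit 𝒜 pt) (u : ↥C.outer → ℝ)
    (i₀ : ↥𝒜 ⊕ ↥ℬ) (r : ℝ) : Coeff 𝒜 ℬ :=
  fun i => ∑ a : ↥C.outer, (if i = Sum.inl ⟨a, C.outer_subset a.2⟩ then u a else 0) +
    if i = i₀ then r else 0

section

variable {ι : Type} {pt : ι → Pt n} (C : ReducedCircuit 𝒜 pt) {u : ↥C.outer → ℝ}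
  {i₀ : ↥𝒜 ⊕ ↥ℬ} {r : ℝ}

theorem sum_mul_circuitCoeff (g : Coeff 𝒜 ℬ) :
    ∑ i, g i * circuitCoeff C u i₀ r i = ∑ a, C.restr g a * u a + g i₀ * r := by
  classical
  simp only [circuitCoeff, mul_add, Finset.mul_sum, Finset.sum_add_distrib]
  rw [Finset.sum_comm]
  congr 1
  · refine Finset.sum_congr rfl fun a _ => ?_
    simp [ReducedCircuit.restr]
  · simp

theorem circuitCoeff_nonneg (hu : ∀ a, 0 ≤ u a) {i : ↥𝒜 ⊕ ↥ℬ} (hi : i ≠ i₀) :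
    0 ≤ circuitCoeff C u i₀ r i := by
  classical
  rw [circuitCoeff, if_neg hi, add_zero]
  exact Finset.sum_nonneg fun a _ => by split_ifs <;> simp [hu a]

theorem circuitCoeff_inr {b : ↥ℬ} (hb : Sum.inr b ≠ i₀) :
    circuitCoeff C u i₀ r (Sum.inr b) = 0 := by
  simp [circuitCoeff, hb]

theorem circuitCoeff_outer (a : ↥C.outer)
    (ha : (Sum.inl ⟨a, C.outer_subset a.2⟩ : ↥𝒜 ⊕ ↥ℬ) ≠ i₀) :
    circuitCoeff C u i₀ r (Sum.inl ⟨a, C.outer_subset a.2⟩) = u a := by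
  classical
  rw [circuitCoeff, if_neg ha, add_zero, Finset.sum_eq_single a]
  · simp
  · intro b _ hb
    rw [if_neg]
    intro h
    simp only [Sum.inl.injEq, Subtype.mk.injEq] at h
    exact hb (Subtype.ext h.symm)
  · simp

end

/-- Pairing with all circuit functions on a circuit yields its circuit inequality. For positive
`v_a`, the coefficients `λ_a s_a` with `s_a = (∏ v_b ^ λ_b) / v_a` are optimal; the general case
follows by perturbing `v`. -/
theorem le_prod_rpow_of_forall {A : Type*} [Fintype A] {lam v : A → ℝ} {t : ℝ}
    (hlam : ∀ a, 0 ≤ lam a) (hsum : ∑ a, lam a = 1) (hv : ∀ a, 0 ≤ v a)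
    (h : ∀ s : A → ℝ, (∀ a, 0 < s a) → t * ∏ a, s a ^ lam a ≤ ∑ a, v a * (lam a * s a)) :
    t ≤ ∏ a, v a ^ lam a := by
  have key : ∀ ε, 0 < ε → t ≤ ∏ a, (v a + ε) ^ lam a := by
    intro ε hε
    have hp : ∀ a, 0 < v a + ε := fun a => by linarith [hv a]
    set G := ∏ a, (v a + ε) ^ lam a with hG
    have hG0 : 0 < G := Finset.prod_pos fun a _ => Real.rpow_pos_of_pos (hp a) _
    have h1 := h (fun a => G / (v a + ε)) fun a => div_pos hG0 (hp a)
    have h2 : ∏ a, (G / (v a + ε)) ^ lam a = 1 := by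
      simp only [Real.div_rpow hG0.le (hp _).le]
      rw [Finset.prod_div_distrib, ← Real.rpow_sum_of_pos hG0, hsum, Real.rpow_one, ← hG,
        div_self hG0.ne']
    rw [h2, mul_one] at h1
    refine h1.trans ?_
    calc ∑ a, v a * (lam a * (G / (v a + ε))) ≤ ∑ a, lam a * G := by
          refine Finset.sum_le_sum fun a _ => ?_
          have h3 : v a * (lam a * (G / (v a + ε))) = lam a * G * (v a / (v a + ε)) := by ring
          rw [h3]
          refine mul_le_of_le_one_right (mul_nonneg (hlam a) hG0.le) ?_
          rw [div_le_one (hp a)]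
          linarith
      _ = G := by rw [← Finset.sum_mul, hsum, one_mul]
  have := le_of_forall_pos_continuous (f := fun _ => t) (g := fun ε => ∏ a, (v a + ε) ^ lam a)
    continuous_const (continuous_finsetProd _ fun a _ =>
      (continuous_const.add continuous_id).rpow_const fun _ => Or.inr (hlam a)) key
  simpa using this

theorem inl_nonneg_of_mem_dualSCone {v : Coeff 𝒜 ℬ} (hv : v ∈ dualSCone 𝒜 ℬ) (α : ↥𝒜) :
    0 ≤ v (Sum.inl α) := by
  classical
  have h := hv (Pi.single (Sum.inl α) 1) (Submodule.subset_span ⟨Or.inl ⟨?_, ?_⟩, fun x => ?_⟩)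
  · simpa [Pi.single_apply] using h
  · intro a a' ha
    rw [Pi.single_apply] at ha
    split_ifs at ha <;> norm_num at ha
  · intro b; simp
  · refine evalFun_nonneg fun _ => ?_
    simp only [Pi.single_apply, mul_ite, mul_one, mul_zero, Finset.sum_ite_eq', Finset.mem_univ,
      if_true, monomials, Sum.elim_inl]
    exact Finset.prod_nonneg fun j _ => Real.rpow_nonneg (abs_nonneg _) _

/-- A vector of the dual cone satisfies the circuit inequality for a coefficient index `i₀` that
carries, up to sign, the monomial of the inner exponent of the circuit. -/
theorem mul_le_geomMean_of_mem_dualSCone {v : Coeff 𝒜 ℬ} (hv : v ∈ dualSCone 𝒜 ℬ) {ι : Type}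
    {pt : ι → Pt n} (C : ReducedCircuit 𝒜 pt) {i₀ : ↥𝒜 ⊕ ↥ℬ} {θ : ℝ}
    (hi₀ : ∀ a : ↥C.outer, (Sum.inl ⟨a, C.outer_subset a.2⟩ : ↥𝒜 ⊕ ↥ℬ) ≠ i₀)
    (hmon : ∀ x, θ * monomials 𝒜 ℬ x i₀ ≤ ∏ j, |x j| ^ C.innerPt j)
    (hAG : ∀ (u : ↥C.outer → ℝ) (r : ℝ), (∀ a, 0 ≤ u a) →
      IsEvenAG (circuitCoeff C u i₀ r) ∨ IsOddAG (circuitCoeff C u i₀ r)) :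
    θ * v i₀ ≤ geomMean C v := by
  have hb := C.isBary
  refine le_prod_rpow_of_forall hb.1 hb.2.1 (fun a => inl_nonneg_of_mem_dualSCone hv _)
    fun s hs => ?_
  have hG : 0 ≤ ∏ a, s a ^ bary C.outer C.innerPt a :=
    Finset.prod_nonneg fun a _ => Real.rpow_nonneg (hs a).le _
  have hu : ∀ a, 0 ≤ bary C.outer C.innerPt a * s a := fun a => mul_nonneg (hb.1 a) (hs a).le
  have h := hv (circuitCoeff C (fun a => bary C.outer C.innerPt a * s a) i₀
    (- (θ * ∏ a, s a ^ bary C.outer C.innerPt a)))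
    (Submodule.subset_span ⟨hAG _ _ hu, fun x => evalFun_nonneg fun hx => ?_⟩)
  · rw [sum_mul_circuitCoeff] at h
    linarith
  · rw [sum_mul_circuitCoeff]
    have h1 := prod_mul_monomial_le hb (fun a => (hs a).le) (x := x) fun a ha => by
      refine hx ⟨a, C.outer_subset a.2⟩ ?_
      rw [circuitCoeff_outer C a (hi₀ a)]
      exact mul_ne_zero ha (hs a).ne'
    have h2 := mul_le_mul_of_nonneg_left (hmon x) hG
    have h3 : ∑ a, C.restr (monomials 𝒜 ℬ x) a * (bary C.outer C.innerPt a * s a) =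
        ∑ a, bary C.outer C.innerPt a * s a * ∏ j, |x j| ^ ((a : Pt n) j) :=
      Finset.sum_congr rfl fun a _ => mul_comm _ _
    rw [h3]
    linarith

theorem even_le_geomMean {v : Coeff 𝒜 ℬ} (hv : v ∈ dualSCone 𝒜 ℬ) (C : EvenCircuit 𝒜) :
    v (Sum.inl C.inner) ≤ geomMean C v := by
  have := mul_le_geomMean_of_mem_dualSCone hv C (i₀ := Sum.inl C.inner) (θ := 1) ?_ ?_ ?_
  · simpa using this
  · intro a h
    apply C.inner_notMem
    have := Sum.inl.inj h
    rw [← this]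
    exact a.2
  · intro x
    rw [one_mul]
    exact le_rfl
  · refine fun u r hu => Or.inl ⟨fun α α' h h' => ?_, fun b => circuitCoeff_inr C (by simp)⟩
    have aux : ∀ α : ↥𝒜, circuitCoeff (ℬ := ℬ) C u (Sum.inl C.inner) r (Sum.inl α) < 0 →
        α = C.inner := fun α h => by
      by_contra hne
      exact absurd (circuitCoeff_nonneg (ℬ := ℬ) (r := r) C hu (i₀ := Sum.inl C.inner)
        (i := Sum.inl α) (by simpa using hne)) (not_le.2 h)
    rw [aux α h, aux α' h']

theorem odd_abs_le_geomMean {v : Coeff 𝒜 ℬ} (hv : v ∈ dualSCone 𝒜 ℬ) (C : OddCircuit 𝒜 ℬ) :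
    |v (Sum.inr C.inner)| ≤ geomMean C v := by
  have key : ∀ θ : ℝ, |θ| = 1 → θ * v (Sum.inr C.inner) ≤ geomMean C v := fun θ hθ => by
    refine mul_le_geomMean_of_mem_dualSCone hv C (by simp) (fun x => ?_)
      fun u r hu => Or.inr ⟨?_, ?_⟩
    · refine (le_abs_self _).trans_eq ?_
      rw [abs_mul, hθ, one_mul, monomials, Sum.elim_inr, Finset.abs_prod]
      refine Finset.prod_congr rfl fun j _ => ?_
      rw [abs_pow]
      exact (Real.rpow_natCast _ _).symm
    · exact fun α => circuitCoeff_nonneg C hu (by simp)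
    · intro b b' h h'
      have aux : ∀ b : ↥ℬ, circuitCoeff C u (Sum.inr C.inner) r (Sum.inr b) ≠ 0 →
          b = C.inner := fun b h => by
        by_contra hne
        exact h (circuitCoeff_inr C (by simpa using hne))
      rw [aux b h, aux b' h']
  rw [abs_le']
  exact ⟨by simpa using key 1 (by simp), by simpa using key (-1) (by simp)⟩

/-- The dual of the S-cone is described by the inequalities between coordinates and weighted
geometric means for the reduced circuits. -/
theorem mem_dualSCone_iff (hℬ : ∀ β ∈ ℬ, ¬ ∀ j, Even (β j)) (hdisj : ∀ β ∈ ℬ, toPt β ∉ 𝒜)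
    (v : Coeff 𝒜 ℬ) :
    v ∈ dualSCone 𝒜 ℬ ↔ (∀ α : ↥𝒜, 0 ≤ v (Sum.inl α)) ∧
      (∀ C : OddCircuit 𝒜 ℬ, |v (Sum.inr C.inner)| ≤ geomMean C v) ∧
      ∀ C : EvenCircuit 𝒜, v (Sum.inl C.inner) ≤ geomMean C v := by
  constructor
  · exact fun hv => ⟨inl_nonneg_of_mem_dualSCone hv, odd_abs_le_geomMean hv, even_le_geomMean hv⟩
  · rintro ⟨h0, hodd, heven⟩
    refine mem_dualSCone_of_forall fun c hc hpos => ?_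
    rcases hc with hc | hc
    · exact pairing_nonneg_of_isEvenAG h0 heven hc hpos
    · exact pairing_nonneg_of_isOddAG hℬ hdisj h0 heven hodd hc hpos

end

/-! ### Positive semidefinite block matrices -/

theorem posSemidef_fromBlocks_zero_iff {m k : Type*} [Fintype m] [Fintype k]
    {A : Matrix m m ℝ} {D : Matrix k k ℝ} :
    (Matrix.fromBlocks A 0 0 D).PosSemidef ↔ A.PosSemidef ∧ D.PosSemidef := by
  constructor
  · exact fun h => ⟨h.submatrix Sum.inl, h.submatrix Sum.inr⟩
  · rintro ⟨hA, hD⟩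
    refine Matrix.PosSemidef.of_dotProduct_mulVec_nonneg ?_ fun x => ?_
    · exact Matrix.IsHermitian.fromBlocks hA.1 (by simp) hD.1
    · rw [← Sum.elim_comp_inl_inr x, Matrix.fromBlocks_mulVec]
      have h1 := hA.dotProduct_mulVec_nonneg (x ∘ Sum.inl)
      have h2 := hD.dotProduct_mulVec_nonneg (x ∘ Sum.inr)
      simp only [dotProduct, Fintype.sum_sum_type] at *
      simpa using add_nonneg h1 h2

theorem posSemidef_blockDiagonal_iff {m o : Type*} [Fintype m] [Fintype o] [DecidableEq o]
    {M : o → Matrix m m ℝ} :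
    (Matrix.blockDiagonal M).PosSemidef ↔ ∀ q, (M q).PosSemidef := by
  constructor
  · intro h q
    have := h.submatrix (fun i : m => (i, q))
    convert this using 1
    ext i j
    simp [Matrix.blockDiagonal_apply]
  · intro h
    refine Matrix.PosSemidef.of_dotProduct_mulVec_nonneg ?_ fun x => ?_
    · rw [Matrix.IsHermitian, Matrix.blockDiagonal_conjTranspose]
      exact congrArg _ (funext fun q => (h q).1)
    · have : star x ⬝ᵥ (Matrix.blockDiagonal M).mulVec x =
          ∑ q, star (fun i => x (i, q)) ⬝ᵥ (M q).mulVec (fun i => x (i, q)) := by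
        simp only [dotProduct, Matrix.mulVec, Fintype.sum_prod_type, Matrix.blockDiagonal_apply]
        rw [Finset.sum_comm]
        refine Finset.sum_congr rfl fun q _ => Finset.sum_congr rfl fun i _ => ?_
        congr 1
        refine Finset.sum_congr rfl fun j _ => ?_
        simp
      rw [this]
      exact Finset.sum_nonneg fun q _ => (h q).dotProduct_mulVec_nonneg _

theorem posSemidef_sym2_iff {a b c : ℝ} :
    (sym2 a b c).PosSemidef ↔ 0 ≤ a ∧ 0 ≤ c ∧ b ^ 2 ≤ a * c := by
  constructor
  · intro h
    have ha : 0 ≤ a := h.diag_nonneg (i := 0)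
    have hc : 0 ≤ c := h.diag_nonneg (i := 1)
    have hd := h.det_nonneg
    rw [sym2, Matrix.det_fin_two_of] at hd
    exact ⟨ha, hc, by linarith⟩
  · rintro ⟨ha, hc, hb⟩
    refine Matrix.PosSemidef.of_dotProduct_mulVec_nonneg ?_ fun x => ?_
    · ext i j; fin_cases i <;> fin_cases j <;> simp [sym2]
    · have h1 : star x ⬝ᵥ (sym2 a b c).mulVec x =
          a * x 0 ^ 2 + 2 * b * (x 0 * x 1) + c * x 1 ^ 2 := by
        simp [sym2, dotProduct, Matrix.mulVec, Fin.sum_univ_two]; ring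
      rw [h1]
      rcases ha.eq_or_lt with rfl | ha
      · have : b = 0 := by nlinarith
        rw [this]; nlinarith [sq_nonneg (x 1)]
      · have h2 : 0 ≤ a * (a * x 0 ^ 2 + 2 * b * (x 0 * x 1) + c * x 1 ^ 2) := by
          nlinarith [sq_nonneg (a * x 0 + b * x 1), sq_nonneg (x 1)]
        exact nonneg_of_mul_nonneg_right h2 ha

theorem posSemidef_sym2_self_iff {y b : ℝ} : (sym2 y b y).PosSemidef ↔ |b| ≤ y := by
  rw [posSemidef_sym2_iff]
  constructor
  · rintro ⟨hy, -, h⟩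
    exact abs_le_of_sq_le_sq (by rwa [← pow_two] at h) hy
  · intro h
    have hy := (abs_nonneg b).trans h
    refine ⟨hy, hy, ?_⟩
    rw [← sq_abs, ← pow_two]
    exact pow_le_pow_left₀ (abs_nonneg b) h 2

/-! ### Binary trees of geometric means -/

theorem prod_Icc_two_mul (f : ℕ → ℝ) (m : ℕ) :
    ∏ j ∈ Finset.Icc 1 (2 * m), f j = ∏ i ∈ Finset.Icc 1 m, f (2 * i - 1) * f (2 * i) := by
  induction m with
  | zero => simp
  | succ m ih =>
    rw [Finset.prod_Icc_succ_top (by omega), ← ih, show 2 * (m + 1) = 2 * m + 1 + 1 by ring,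
      Finset.prod_Icc_succ_top (by omega), Finset.prod_Icc_succ_top (by omega),
      show 2 * m + 1 + 1 - 1 = 2 * m + 1 by omega]
    ring

/-- In a binary tree whose entries are bounded by the geometric mean of their two children, the
root is bounded by the geometric mean of the leaves. -/
theorem pow_root_le_prod_leaves {L : ℕ} {e : ℕ → ℕ → ℝ}
    (h : ∀ k < L, ∀ i ∈ Finset.Icc 1 (2 ^ (L - (k + 1))),
      e (k + 1) i ^ 2 ≤ e k (2 * i - 1) * e k (2 * i)) :
    e L 1 ^ 2 ^ L ≤ ∏ i ∈ Finset.Icc 1 (2 ^ L), e 0 i := by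
  have key : ∀ k ≤ L, ∏ i ∈ Finset.Icc 1 (2 ^ (L - k)), e k i ^ 2 ^ k ≤
      ∏ i ∈ Finset.Icc 1 (2 ^ L), e 0 i := by
    intro k
    induction k with
    | zero => simp
    | succ k ih =>
      intro hk
      refine le_trans ?_ (ih (by omega))
      have h2 : 2 ^ (L - k) = 2 * 2 ^ (L - (k + 1)) := by
        rw [← pow_succ']; congr 1; omega
      rw [h2, prod_Icc_two_mul]
      refine Finset.prod_le_prod (fun i _ => ?_) fun i hi => ?_
      · rw [pow_succ', pow_mul]; positivity
      · rw [pow_succ', pow_mul, ← mul_pow]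
        exact pow_le_pow_left₀ (sq_nonneg _) (h k (by omega) i hi) _
  simpa using key L le_rfl

/-- The binary tree of iterated geometric means. -/
def meanTree (leaf : ℕ → ℝ) : ℕ → ℕ → ℝ
  | 0, i => leaf i
  | k + 1, i => √(meanTree leaf k (2 * i - 1) * meanTree leaf k (2 * i))

theorem meanTree_nonneg {leaf : ℕ → ℝ} (h : ∀ i, 0 ≤ leaf i) (k i : ℕ) :
    0 ≤ meanTree leaf k i := by
  cases k with
  | zero => exact h i
  | succ k => exact Real.sqrt_nonneg _

theorem meanTree_succ_sq {leaf : ℕ → ℝ} (h : ∀ i, 0 ≤ leaf i) (k i : ℕ) :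
    meanTree leaf (k + 1) i ^ 2 = meanTree leaf k (2 * i - 1) * meanTree leaf k (2 * i) :=
  Real.sq_sqrt (mul_nonneg (meanTree_nonneg h _ _) (meanTree_nonneg h _ _))

theorem prod_leaves_eq_pow_meanTree {leaf : ℕ → ℝ} (h : ∀ i, 0 ≤ leaf i) (L : ℕ) :
    ∏ i ∈ Finset.Icc 1 (2 ^ L), leaf i = meanTree leaf L 1 ^ 2 ^ L := by
  have key : ∀ k ≤ L, ∏ i ∈ Finset.Icc 1 (2 ^ L), leaf i =
      ∏ i ∈ Finset.Icc 1 (2 ^ (L - k)), meanTree leaf k i ^ 2 ^ k := by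
    intro k
    induction k with
    | zero => simp [meanTree]
    | succ k ih =>
      intro hk
      rw [ih (by omega)]
      have h2 : 2 ^ (L - k) = 2 * 2 ^ (L - (k + 1)) := by
        rw [← pow_succ']; congr 1; omega
      rw [h2, prod_Icc_two_mul]
      refine Finset.prod_congr rfl fun i _ => ?_
      rw [← mul_pow, ← meanTree_succ_sq h, pow_succ' 2 k, pow_mul]
  simpa using key L le_rfl

/-! ### The dual circuit matrix of an arrangement -/

section Tree

variable {n : ℕ} {A : Finset (Pt n)} {β : Pt n}

theorem node_zero (σ : Arrangement A β) (vA : ↥A → ℝ) (t : ℝ)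
    (y : ↥(varIndex (depth A β)) → ℝ) (i : ℕ) :
    node σ vA t y 0 i = if h : i ∈ Finset.Icc 1 (2 ^ depth A β) then leafVar σ vA t ⟨i, h⟩ else 0 :=
  if_pos rfl

theorem node_depth (hL : 1 ≤ depth A β) (σ : Arrangement A β) (vA : ↥A → ℝ) (t : ℝ)
    (y : ↥(varIndex (depth A β)) → ℝ) (i : ℕ) : node σ vA t y (depth A β) i = t := by
  rw [node, if_neg (by omega), if_pos rfl]

theorem leafVar_nonneg (σ : Arrangement A β) {vA : ↥A → ℝ} {t : ℝ} (hv : ∀ a, 0 ≤ vA a)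
    (ht : 0 ≤ t) (i : ↥(Finset.Icc 1 (2 ^ depth A β))) : 0 ≤ leafVar σ vA t i := by
  unfold leafVar
  split
  · exact hv _
  · exact ht

theorem prod_node_zero (σ : Arrangement A β) (vA : ↥A → ℝ) (t : ℝ)
    (y : ↥(varIndex (depth A β)) → ℝ) :
    ∏ i ∈ Finset.Icc 1 (2 ^ depth A β), node σ vA t y 0 i =
      t ^ (2 ^ depth A β - denom A β) * ∏ a, vA a ^ numer A β a := by
  classical
  rw [← Finset.prod_coe_sort]
  have h1 : ∀ i : ↥(Finset.Icc 1 (2 ^ depth A β)), node σ vA t y 0 i =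
      (σ.slot i).elim t vA := fun i => by
    rw [node_zero, dif_pos i.2, leafVar]
    cases σ.slot i <;> rfl
  simp only [h1]
  rw [← Fintype.prod_fiberwise σ.slot]
  have h2 : ∀ o : Option ↥A, ∏ i : {i // σ.slot i = o}, (σ.slot i).elim t vA =
      (o.elim t vA) ^ Nat.card {i // σ.slot i = o} := fun o => by
    rw [Finset.prod_congr rfl fun i _ => by rw [i.2], Finset.prod_const, Nat.card_eq_fintype_card,
      Finset.card_univ]
  simp only [h2, Fintype.prod_option, σ.card_inner, σ.card_outer, Option.elim_none,
    Option.elim_some]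

theorem posSemidef_dualCircuitMatrix_iff (σ : Arrangement A β) (vA : ↥A → ℝ) (t : ℝ)
    (y : ↥(varIndex (depth A β)) → ℝ) :
    (dualCircuitMatrix σ vA t y).PosSemidef ↔
      (∀ k i, 1 ≤ k → k ≤ depth A β → i ∈ Finset.Icc 1 (2 ^ (depth A β - k)) →
        (sym2 (node σ vA t y (k - 1) (2 * i - 1)) (node σ vA t y k i)
          (node σ vA t y (k - 1) (2 * i))).PosSemidef) ∧ 0 ≤ t := by
  rw [dualCircuitMatrix, posSemidef_fromBlocks_zero_iff, posSemidef_blockDiagonal_iff]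
  refine and_congr ?_ ?_
  · constructor
    · intro h k i h1 h2 hi
      exact h ⟨⟨k, i⟩, Finset.mem_sigma.2 ⟨Finset.mem_Icc.2 ⟨h1, h2⟩, hi⟩⟩
    · rintro h ⟨⟨k, i⟩, hq⟩
      have hq' := Finset.mem_sigma.1 hq
      have hk := Finset.mem_Icc.1 hq'.1
      exact h k i hk.1 hk.2 hq'.2
  · constructor
    · intro h; exact h.diag_nonneg (i := ())
    · intro h
      have : (Matrix.of fun _ _ => t : Matrix Unit Unit ℝ) = Matrix.diagonal fun _ => t := by
        ext i j; simp [Matrix.diagonal]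
      rw [this]
      exact Matrix.PosSemidef.diagonal fun _ => h

/-- The dual circuit matrix can be completed to a positive semidefinite one if and only if the
root variable is non-negative and at most the geometric mean of the leaves; the `2 ^ L - p` leaves
that carry the root variable itself turn the exponent `2 ^ L` into `p`. -/
theorem exists_posSemidef_dualCircuitMatrix_iff (hL : 1 ≤ depth A β) (hp : 0 < denom A β)
    (σ : Arrangement A β) {vA : ↥A → ℝ} (hv : ∀ a, 0 ≤ vA a) (t : ℝ) :
    (∃ y, (dualCircuitMatrix σ vA t y).PosSemidef) ↔
      0 ≤ t ∧ t ^ denom A β ≤ ∏ a, vA a ^ numer A β a := by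
  have hle : denom A β ≤ 2 ^ depth A β := Nat.le_pow_clog (by norm_num) _
  have hsplit : t ^ 2 ^ depth A β = t ^ (2 ^ depth A β - denom A β) * t ^ denom A β := by
    rw [← pow_add]; congr 1; omega
  constructor
  · rintro ⟨y, hy⟩
    rw [posSemidef_dualCircuitMatrix_iff] at hy
    obtain ⟨hy, ht⟩ := hy
    refine ⟨ht, ?_⟩
    have := pow_root_le_prod_leaves (L := depth A β) (e := node σ vA t y) fun k hk i hi =>
      (posSemidef_sym2_iff.1 (hy (k + 1) i (by omega) (by omega) hi)).2.2
    rw [node_depth hL, prod_node_zero, hsplit] at this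
    -- cancel the leaves that carry `t`, which needs `t ≠ 0`
    rcases ht.eq_or_lt with rfl | ht
    · rw [zero_pow hp.ne']
      exact Finset.prod_nonneg fun a _ => pow_nonneg (hv a) _
    · exact le_of_mul_le_mul_left this (pow_pos ht _)
  · rintro ⟨ht, hle'⟩
    let leaf : ℕ → ℝ := fun i =>
      if h : i ∈ Finset.Icc 1 (2 ^ depth A β) then leafVar σ vA t ⟨i, h⟩ else 0
    have hleaf : ∀ i, 0 ≤ leaf i := fun i => by
      by_cases h : i ∈ Finset.Icc 1 (2 ^ depth A β)
      · simp only [leaf, dif_pos h]; exact leafVar_nonneg σ hv ht _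
      · simp only [leaf, dif_neg h]; exact le_rfl
    let g := meanTree leaf
    let y : ↥(varIndex (depth A β)) → ℝ := fun q => g q.1.1 q.1.2
    have hnode : ∀ k < depth A β, ∀ i ∈ Finset.Icc 1 (2 ^ (depth A β - k)),
        node σ vA t y k i = g k i := by
      intro k hk i hi
      rcases Nat.eq_zero_or_pos k with rfl | hk0
      · exact node_zero σ vA t y i
      · have hmem : (⟨k, i⟩ : Σ _ : ℕ, ℕ) ∈ varIndex (depth A β) :=
          Finset.mem_sigma.2 ⟨Finset.mem_Icc.2 ⟨hk0, Nat.le_sub_one_of_lt hk⟩, hi⟩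
        rw [node, if_neg (by omega), if_neg (by omega), dif_pos hmem]
    have hroot : t ≤ g (depth A β) 1 := by
      have h1 := prod_leaves_eq_pow_meanTree hleaf (depth A β)
      have h2 := prod_node_zero σ vA t y
      rw [Finset.prod_congr rfl fun i _ => node_zero σ vA t y i, h1] at h2
      refine le_of_pow_le_pow_left₀ (n := 2 ^ depth A β) (by positivity)
        (meanTree_nonneg hleaf _ _) ?_
      rw [h2, hsplit]
      exact mul_le_mul_of_nonneg_left hle' (pow_nonneg ht _)
    refine ⟨y, (posSemidef_dualCircuitMatrix_iff σ vA t y).2 ⟨fun k i h1 h2 hi => ?_, ht⟩⟩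
    obtain ⟨k, rfl⟩ : ∃ m, k = m + 1 := ⟨k - 1, by omega⟩
    rw [Finset.mem_Icc] at hi
    have hpow : 2 ^ (depth A β - k) = 2 * 2 ^ (depth A β - (k + 1)) := by
      rw [← pow_succ']; congr 1; omega
    rw [Nat.add_sub_cancel, hnode k (by omega) _ (Finset.mem_Icc.2 ⟨by omega, by omega⟩),
      hnode k (by omega) _ (Finset.mem_Icc.2 ⟨by omega, by omega⟩), posSemidef_sym2_iff]
    refine ⟨meanTree_nonneg hleaf _ _, meanTree_nonneg hleaf _ _, ?_⟩
    rw [← meanTree_succ_sq hleaf]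
    rcases h2.lt_or_eq with h2 | h2
    · rw [hnode (k + 1) h2 i (Finset.mem_Icc.2 hi)]
    · rw [h2, Nat.sub_self, pow_zero] at hi
      obtain rfl : i = 1 := by omega
      rw [h2, node_depth hL]
      exact pow_le_pow_left₀ ht hroot 2

end Tree

/-! ### Circuits with rational exponents -/

section Circuit

variable {n : ℕ} {𝒜 : Finset (Pt n)} {ℬ : Finset (Fin n → ℕ)} {ι : Type} {pt : ι → Pt n}

theorem ReducedCircuit.denom_spec (C : ReducedCircuit 𝒜 pt)
    (hrat : ∀ α ∈ 𝒜, ∀ j, ∃ q : ℚ, α j = (q : ℝ))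
    (hβ : ∀ j, ∃ q : ℚ, C.innerPt j = (q : ℝ)) :
    0 < denom C.outer C.innerPt ∧ ∀ a, bary C.outer C.innerPt a =
      (numer C.outer C.innerPt a : ℝ) / (denom C.outer C.innerPt : ℝ) :=
  SCone.denom_spec (C.isBary.rational C.affineIndependent
    (fun a ha => hrat a (C.outer_subset ha)) hβ) C.isBary.1

/-- The common denominator is not `1`, since the inner exponent is not an outer one; hence the
binary tree of a circuit has at least one level of blocks. -/
theorem ReducedCircuit.one_le_depth (C : ReducedCircuit 𝒜 pt)
    (hrat : ∀ α ∈ 𝒜, ∀ j, ∃ q : ℚ, α j = (q : ℝ))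
    (hβ : ∀ j, ∃ q : ℚ, C.innerPt j = (q : ℝ)) : 1 ≤ depth C.outer C.innerPt := by
  classical
  obtain ⟨hp, hn⟩ := C.denom_spec hrat hβ
  obtain ⟨-, h1, h2⟩ := C.isBary
  refine Nat.clog_pos (by norm_num) ?_
  by_contra! hlt
  have hone : denom C.outer C.innerPt = 1 := by omega
  simp only [hone, Nat.cast_one, div_one] at hn
  simp only [hn] at h1 h2
  have hsum : ∑ a, numer C.outer C.innerPt a = 1 := by exact_mod_cast h1
  obtain ⟨a, -, ha⟩ : ∃ a ∈ Finset.univ, numer C.outer C.innerPt a ≠ 0 := by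
    by_contra! hcon
    rw [Finset.sum_eq_zero hcon] at hsum
    exact zero_ne_one hsum
  rw [← Finset.add_sum_erase _ _ (Finset.mem_univ a)] at hsum
  have hzero : ∀ b ∈ Finset.univ.erase a, numer C.outer C.innerPt b = 0 :=
    Finset.sum_eq_zero_iff.1 (by omega)
  have hna : numer C.outer C.innerPt a = 1 := by
    rw [Finset.sum_eq_zero hzero] at hsum; omega
  rw [← Finset.add_sum_erase _ _ (Finset.mem_univ a),
    Finset.sum_eq_zero fun b hb => by rw [hzero b hb, Nat.cast_zero, zero_smul], hna,
    Nat.cast_one, one_smul, add_zero] at h2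
  exact C.inner_notMem (show C.innerPt ∈ C.outer from h2 ▸ a.2)

theorem ReducedCircuit.restr_nonneg (C : ReducedCircuit 𝒜 pt) {v : Coeff 𝒜 ℬ}
    (hv : ∀ α : ↥𝒜, 0 ≤ v (Sum.inl α)) (a : ↥C.outer) : 0 ≤ C.restr v a :=
  hv _

theorem le_geomMean_iff (C : ReducedCircuit 𝒜 pt)
    (hrat : ∀ α ∈ 𝒜, ∀ j, ∃ q : ℚ, α j = (q : ℝ))
    (hβ : ∀ j, ∃ q : ℚ, C.innerPt j = (q : ℝ)) {v : Coeff 𝒜 ℬ}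
    (hv : ∀ α : ↥𝒜, 0 ≤ v (Sum.inl α)) {t : ℝ} (ht : 0 ≤ t) :
    t ≤ geomMean C v ↔
      t ^ denom C.outer C.innerPt ≤ ∏ a, C.restr v a ^ numer C.outer C.innerPt a := by
  obtain ⟨hp, hn⟩ := C.denom_spec hrat hβ
  have hpow : geomMean C v ^ denom C.outer C.innerPt =
      ∏ a, C.restr v a ^ numer C.outer C.innerPt a := by
    rw [geomMean, ← Finset.prod_pow]
    refine Finset.prod_congr rfl fun a _ => ?_
    have hp' : (denom C.outer C.innerPt : ℝ) ≠ 0 := by exact_mod_cast hp.ne'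
    rw [← Real.rpow_natCast, ← Real.rpow_mul (C.restr_nonneg hv a), hn, div_mul_cancel₀ _ hp',
      Real.rpow_natCast]
  rw [← hpow]
  exact (pow_le_pow_iff_left₀ ht
    (Finset.prod_nonneg fun a _ => Real.rpow_nonneg (C.restr_nonneg hv a) _) hp.ne').symm

theorem exists_posSemidef_iff_le_geomMean (C : ReducedCircuit 𝒜 pt)
    (hrat : ∀ α ∈ 𝒜, ∀ j, ∃ q : ℚ, α j = (q : ℝ))
    (hβ : ∀ j, ∃ q : ℚ, C.innerPt j = (q : ℝ)) (σ : C.Arr) {v : Coeff 𝒜 ℬ}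
    (hv : ∀ α : ↥𝒜, 0 ≤ v (Sum.inl α)) (t : ℝ) :
    (∃ y, (dualCircuitMatrix σ (C.restr v) t y).PosSemidef) ↔ 0 ≤ t ∧ t ≤ geomMean C v := by
  rw [exists_posSemidef_dualCircuitMatrix_iff (C.one_le_depth hrat hβ)
    (C.denom_spec hrat hβ).1 σ (C.restr_nonneg hv) t]
  exact and_congr_right fun ht => (le_geomMean_iff C hrat hβ hv ht).symm

theorem posSemidef_liftedCircuitMatrix_iff (C : ReducedCircuit 𝒜 pt) (σ : C.Arr)
    (vA : ↥C.outer → ℝ) (vβ yβ : ℝ) (y : C.Vars) :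
    (liftedCircuitMatrix σ vA vβ yβ y).PosSemidef ↔
      (dualCircuitMatrix σ vA yβ y).PosSemidef ∧ |vβ| ≤ yβ := by
  rw [liftedCircuitMatrix, posSemidef_fromBlocks_zero_iff, posSemidef_sym2_self_iff]

theorem exists_posSemidef_lifted_iff (C : ReducedCircuit 𝒜 pt)
    (hrat : ∀ α ∈ 𝒜, ∀ j, ∃ q : ℚ, α j = (q : ℝ))
    (hβ : ∀ j, ∃ q : ℚ, C.innerPt j = (q : ℝ)) (σ : C.Arr) {v : Coeff 𝒜 ℬ}
    (hv : ∀ α : ↥𝒜, 0 ≤ v (Sum.inl α)) (vβ : ℝ) :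
    (∃ z : ℝ × C.Vars, (liftedCircuitMatrix σ (C.restr v) vβ z.1 z.2).PosSemidef) ↔
      |vβ| ≤ geomMean C v := by
  simp only [posSemidef_liftedCircuitMatrix_iff]
  constructor
  · rintro ⟨⟨t, y⟩, h1, h2⟩
    exact h2.trans ((exists_posSemidef_iff_le_geomMean C hrat hβ σ hv t).1 ⟨y, h1⟩).2
  · intro h
    obtain ⟨y, hy⟩ := (exists_posSemidef_iff_le_geomMean C hrat hβ σ hv |vβ|).2 ⟨abs_nonneg _, h⟩
    exact ⟨⟨_, y⟩, hy, le_rfl⟩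

/-- The four conditions of an odd circuit are the blocks of the lifted circuit matrix. The levels
`k = 1` and `k = L` of the blocks coincide if `L = 1`. -/
theorem oddCondition_iff (C : OddCircuit 𝒜 ℬ) (hL : 1 ≤ depth C.outer C.innerPt) (σ : C.Arr)
    (v : Coeff 𝒜 ℬ) (yβ : ℝ) (y : C.Vars) :
    OddCondition C σ v yβ y ↔
      (liftedCircuitMatrix σ (C.restr v) (v (Sum.inr C.inner)) yβ y).PosSemidef := by
  rw [posSemidef_liftedCircuitMatrix_iff, posSemidef_dualCircuitMatrix_iff]
  simp only [OddCondition, Real.norm_eq_abs]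
  constructor
  · rintro ⟨h1, h2, h3, h4⟩
    refine ⟨⟨fun k i hk1 hkL hi => ?_, (abs_nonneg _).trans h4⟩, h4⟩
    rcases hk1.eq_or_lt with rfl | hk1
    · exact h3 i hi
    rcases hkL.eq_or_lt with rfl | hkL
    · rw [Nat.sub_self, pow_zero, Finset.Icc_self, Finset.mem_singleton] at hi
      subst hi
      rw [node_depth hL]
      exact h2
    · exact h1 k i hk1 (by omega) hi
  · rintro ⟨⟨h, -⟩, h4⟩
    refine ⟨fun k i hk1 hkL hi => h k i (by omega) (by omega) hi, ?_,
      fun l hl => h 1 l le_rfl hL hl, h4⟩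
    have := h (depth C.outer C.innerPt) 1 hL le_rfl (by simp)
    rwa [node_depth hL] at this

end Circuit

end SCone

end

theorem mainTheorem2 {n : ℕ} (𝒜 : Finset (Fin n → ℝ)) (ℬ : Finset (Fin n → ℕ))
    (h𝒜 : 𝒜.Nonempty)
    (hrat : ∀ α ∈ 𝒜, ∀ j, ∃ q : ℚ, α j = (q : ℝ))
    (hℬ : ∀ β ∈ ℬ, ¬ ∀ j, Even (β j))
    (hdisj : ∀ β ∈ ℬ, SCone.toPt β ∉ 𝒜)
    (σodd : ∀ C : SCone.OddCircuit 𝒜 ℬ, C.Arr)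
    (σeven : ∀ C : SCone.EvenCircuit 𝒜, C.Arr) :
    (∀ v : SCone.Coeff 𝒜 ℬ,
      v ∈ SCone.dualSCone 𝒜 ℬ ↔
        ∃ (yodd : SCone.OddVars 𝒜 ℬ) (yeven : SCone.EvenVars 𝒜),
          (∀ α : ↥𝒜, 0 ≤ v (Sum.inl α)) ∧
          (∀ C : SCone.OddCircuit 𝒜 ℬ,
            SCone.OddCondition C (σodd C) v (yodd C).1 (yodd C).2) ∧
          (∀ C : SCone.EvenCircuit 𝒜, SCone.EvenCondition C (σeven C) v (yeven C))) ∧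
    SCone.dualSCone 𝒜 ℬ = Prod.fst '' SCone.liftedDualCone 𝒜 ℬ σodd σeven := by
  have hβeven : ∀ (C : SCone.EvenCircuit 𝒜) (j), ∃ q : ℚ, C.innerPt j = (q : ℝ) := fun C j =>
    hrat _ C.inner.2 j
  have hβodd : ∀ (C : SCone.OddCircuit 𝒜 ℬ) (j), ∃ q : ℚ, C.innerPt j = (q : ℝ) := fun C j =>
    ⟨((C.inner : Fin n → ℕ) j : ℚ), (Rat.cast_natCast _).symm⟩
  have hmem : ∀ v : SCone.Coeff 𝒜 ℬ, v ∈ SCone.dualSCone 𝒜 ℬ ↔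
      ∃ (yodd : SCone.OddVars 𝒜 ℬ) (yeven : SCone.EvenVars 𝒜),
        (v, yodd, yeven) ∈ SCone.liftedDualCone 𝒜 ℬ σodd σeven := by
    intro v
    rw [SCone.mem_dualSCone_iff hℬ hdisj]
    constructor
    · rintro ⟨h0, hodd, heven⟩
      choose yodd hyodd using fun C => (SCone.exists_posSemidef_lifted_iff C hrat (hβodd C)
        (σodd C) h0 _).2 (hodd C)
      choose yeven hyeven using fun C : SCone.EvenCircuit 𝒜 =>
        (SCone.exists_posSemidef_iff_le_geomMean C hrat (hβeven C)
          (σeven C) h0 _).2 ⟨h0 C.inner, heven C⟩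
      exact ⟨yodd, yeven, h0, hyodd, hyeven⟩
    · rintro ⟨yodd, yeven, h0, hyodd, hyeven⟩
      exact ⟨h0, fun C => (SCone.exists_posSemidef_lifted_iff C hrat (hβodd C) (σodd C) h0 _).1
        ⟨_, hyodd C⟩, fun C => ((SCone.exists_posSemidef_iff_le_geomMean C hrat (hβeven C)
          (σeven C) h0 _).1 ⟨_, hyeven C⟩).2⟩
  refine ⟨fun v => (hmem v).trans (exists_congr fun yodd => exists_congr fun yeven =>
    and_congr_right fun _ => and_congr_left fun _ => forall_congr' fun C =>
      (SCone.oddCondition_iff C (C.one_le_depth hrat (hβodd C)) (σodd C) v _ _).symm), ?_⟩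
  ext v
  rw [hmem]
  constructor
  · rintro ⟨yodd, yeven, h⟩
    exact ⟨_, h, rfl⟩
  · rintro ⟨⟨_, yodd, yeven⟩, h, rfl⟩
    exact ⟨yodd, yeven, h⟩
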